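/- All graphs are simple and undirected, with vertex set $[n]$. A randomized query algorithm may use internal randomness and accesses the unknown graph $G=([n],E)$ only through adaptive queries of three types: an independent-set query (given $U\subseteq[n]$, is $U$ independent in $G$?), a degree query (given $u\in[n]$, returns $\deg(u)$), and a random-neighbor query (given $u\in[n]$, returns a uniformly random neighbor of $u$, drawn independently at every call, or a special symbol if $u$ has no neighbor). **Theorem.** There are an absolute constant $C>0$ and a randomized query algorithm that takes as input an integer $n\ge 1$ and a parameter $\varepsilon\in(0,1]$ and has query access to a graph $G=([n],E)$ such that for all $n$, $\varepsilon$ and $G$, with $m=|E|$, the following holds. 1. The algorithm halts almost surely and outputs a real number $\tilde m$ with $$\Pr\bigl[(1-\varepsilon)m\le \tilde m\le (1+\varepsilon)m\bigr]\ge \tfrac23 .$$ 2. If $m\ge 1$, the expected number of queries is at most $$C\cdot\frac{\log n}{\varepsilon^{5/2}}\cdot\min\left(\sqrt m,\ \sqrt{\frac{n}{\sqrt m}}\right).$$ If $m=0$, the expected number of queries is at most $1$. -/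

import Mathlib

/-- The queries available on an unknown graph with vertex set `Fin n`. -/
inductive GraphQuery (n : ℕ) : Type
  /-- Is the vertex set `U` independent? -/
  | indep (U : Finset (Fin n))
  /-- What is the degree of `u`? -/
  | degree (u : Fin n)
  /-- Give a uniformly random neighbor of `u`. -/
  | neighbor (u : Fin n)

/-- The type of answers to a query. A random-neighbor query is answered by `none` on an
isolated vertex. -/
def GraphQuery.Answer {n : ℕ} : GraphQuery n → Type
  | .indep _ => Bool
  | .degree _ => ℕ
  | .neighbor _ => Option (Fin n)

open Classical in
/-- The law of the answer of the oracles of the graph `G` to a query. Independent-set and degree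
queries are answered deterministically; a random-neighbor query is answered with fresh
randomness at every call. -/
noncomputable def graphOracle {n : ℕ} (G : SimpleGraph (Fin n)) :
    (q : GraphQuery n) → PMF q.Answer
  | .indep U => (PMF.pure (decide (G.IsIndepSet (U : Set (Fin n)))) : PMF Bool)
  | .degree u => (PMF.pure (G.degree u) : PMF ℕ)
  | .neighbor u =>
      if h : (G.neighborFinset u).Nonempty then
        ((PMF.uniformOfFinset (G.neighborFinset u) h).map some : PMF (Option (Fin n)))
      else (PMF.pure none : PMF (Option (Fin n)))

/-- What an algorithm with internal states in `σ` does in one step: ask one query and continue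
according to the answer, make an internal random move, or halt and output a real number. -/
inductive GraphAction (n : ℕ) (σ : Type) : Type
  | query (q : GraphQuery n) (next : q.Answer → σ)
  | toss (p : PMF σ)
  | output (r : ℝ)

/-- A randomized adaptive query algorithm for graphs with vertex set `Fin n`. The graph is
accessible only through the answers to the queries. -/
structure GraphAlgorithm (n : ℕ) where
  /-- internal states -/
  State : Type
  /-- initial state -/
  start : State
  /-- action taken in each state -/
  act : State → GraphAction n State

namespace GraphAlgorithm

variable {n : ℕ} (A : GraphAlgorithm n) (G : SimpleGraph (Fin n))

/-- One step of the execution of `A` on `G`. A configuration consists of the internal state and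
of the number of queries made so far; after an output the configuration no longer changes. -/
noncomputable def step (c : A.State × ℕ) : PMF (A.State × ℕ) :=
  match A.act c.1 with
  | .query q next => (graphOracle G q).map fun a => (next a, c.2 + 1)
  | .toss p => p.map fun s => (s, c.2)
  | .output _ => PMF.pure c

/-- The law of the configuration of `A` on `G` after `t` steps. -/
noncomputable def run : ℕ → PMF (A.State × ℕ)
  | 0 => PMF.pure (A.start, 0)
  | t + 1 => (run t).bind (A.step G)

/-- The probability that `A`, run on `G`, halts with an output in `S`: the limit (supremum) over
`t` of the probability that this has happened within `t` steps. -/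
noncomputable def outputProb (S : Set ℝ) : ENNReal :=
  ⨆ t : ℕ, (A.run G t).toOuterMeasure {c | ∃ r ∈ S, A.act c.1 = .output r}

/-- The expected total number of queries that `A` makes on `G`: the limit (supremum) over `t` of
the expected number of queries made within `t` steps. -/
noncomputable def expectedQueries : ENNReal :=
  ⨆ t : ℕ, ∑' c : A.State × ℕ, A.run G t c * (c.2 : ENNReal)

end GraphAlgorithm

/-!
Color the vertices at random with `N` colors. All edges inside one color class can be found by
binary splitting with `O(log n)` independent-set queries per edge, so it is cheap to search the
first `r` classes. An edge lies in one of them with probability `r / N ^ 2`, and disjoint edges do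
so independently. Hence the rescaled number of edges found is an unbiased estimator for `m`, whose
variance is small except for the contribution of vertices of large degree. Edges at vertices of
degree at least `θ` are instead estimated by sampling a random vertex and random neighbors of it:
there are at most `2 * m / θ` such vertices, which bounds the variance of this estimator.

The right parameters depend on `m`, which is guessed from below, by `4 ^ i`, and from above, by
about `(n / 4 ^ i) ^ 2`. At level `i` both guesses are tried, with `O(2 ^ i * log n / ε ^ 2)`
queries. By Chebyshev's inequality an estimate that contradicts its guess is unlikely when the guess
has passed `m`, and an inaccurate estimate that agrees with a guess still `4 ^ j` times too small or
too large has probability `O(4 ^ (-j))`. So the errors up to the first level `l` at which a guess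
passes `m` form a geometric series. The probability of reaching a later level decreases faster than
its cost grows. The search therefore costs `O(2 ^ l * log n / ε ^ 2)` queries, and `2 ^ l` is at
most `3 * min √m √(n / √m)`.
-/

open scoped BigOperators


section Expectation

variable {α β : Type*} (p : PMF α)

/-- The expected value of the real function `f` under `p`. It is meant for laws `p` of finite
support, where every `f` is summable. -/
noncomputable def pmfMean (p : PMF α) (f : α → ℝ) : ℝ := ∑' a, (p a).toReal * f a

lemma pmfMean_const (c : ℝ) : pmfMean p (fun _ => c) = c := by
  rw [pmfMean, tsum_mul_right, ← ENNReal.tsum_toReal_eq p.apply_ne_top, p.tsum_coe,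
    ENNReal.toReal_one, one_mul]

lemma pmfMean_const_mul (c : ℝ) (f : α → ℝ) : pmfMean p (fun a => c * f a) = c * pmfMean p f := by
  simp only [pmfMean, mul_left_comm _ c, tsum_mul_left]

lemma pmfMean_nonneg {f : α → ℝ} (hf : ∀ a, 0 ≤ f a) : 0 ≤ pmfMean p f :=
  tsum_nonneg fun a => mul_nonneg ENNReal.toReal_nonneg (hf a)

lemma pmfMean_pure (a : α) (f : α → ℝ) : pmfMean (PMF.pure a) f = f a := by
  rw [pmfMean, tsum_eq_single a fun b hb => by simp [PMF.pure_apply, hb]]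
  simp

lemma pmfMean_map_of_injective {g : α → β} (hg : Function.Injective g) (f : β → ℝ) :
    pmfMean (p.map g) f = pmfMean p fun a => f (g a) := by
  have happly (a : α) : p.map g (g a) = p a := by
    rw [PMF.map_apply, tsum_eq_single a fun b hb => if_neg fun h => hb (hg h).symm, if_pos rfl]
  have hsupp : Function.support (fun b => (p.map g b).toReal * f b) ⊆ Set.range g := by
    intro b hb
    obtain ⟨a, -, rfl⟩ : b ∈ g '' p.support := by
      rw [← PMF.support_map, PMF.mem_support_iff]
      exact fun h => hb (by simp [h])
    exact ⟨a, rfl⟩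
  simp only [pmfMean, ← hg.tsum_eq hsupp, happly]

lemma pmfMean_uniformOfFinset {s : Finset α} (hs : s.Nonempty) (f : α → ℝ) :
    pmfMean (PMF.uniformOfFinset s hs) f = 𝔼 a ∈ s, f a := by
  rw [pmfMean, tsum_eq_sum (s := s) fun a ha => by simp [ha], Finset.expect_eq_sum_div_card,
    Finset.sum_div]
  refine Finset.sum_congr rfl fun a ha => ?_
  rw [PMF.uniformOfFinset_apply_of_mem hs ha, ENNReal.toReal_inv, ENNReal.toReal_natCast,
    inv_mul_eq_div]

lemma pmfMean_uniformOfFintype [Fintype α] [Nonempty α] (f : α → ℝ) :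
    pmfMean (PMF.uniformOfFintype α) f = 𝔼 a, f a :=
  pmfMean_uniformOfFinset Finset.univ_nonempty f

section FiniteSupport

variable {p}

lemma summable_toReal_mul (hp : p.support.Finite) (f : α → ℝ) :
    Summable fun a => (p a).toReal * f a :=
  summable_of_hasFiniteSupport <| hp.subset fun a ha => by
    rw [PMF.mem_support_iff]
    exact fun h => ha (by simp [h])

lemma pmfMean_add (hp : p.support.Finite) (f g : α → ℝ) :
    pmfMean p (fun a => f a + g a) = pmfMean p f + pmfMean p g := by
  simp only [pmfMean, mul_add, (summable_toReal_mul hp f).tsum_add (summable_toReal_mul hp g)]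

lemma pmfMean_mono (hp : p.support.Finite) {f g : α → ℝ} (h : ∀ a, f a ≤ g a) :
    pmfMean p f ≤ pmfMean p g :=
  (summable_toReal_mul hp f).tsum_le_tsum
    (fun a => mul_le_mul_of_nonneg_left (h a) ENNReal.toReal_nonneg) (summable_toReal_mul hp g)

lemma tsum_mul_ofReal (hp : p.support.Finite) {f : α → ℝ} (hf : ∀ a, 0 ≤ f a) :
    ∑' a, p a * ENNReal.ofReal (f a) = ENNReal.ofReal (pmfMean p f) := by
  rw [pmfMean, ENNReal.ofReal_tsum_of_nonneg
    (fun a => mul_nonneg ENNReal.toReal_nonneg (hf a)) (summable_toReal_mul hp f)]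
  refine tsum_congr fun a => ?_
  rw [ENNReal.ofReal_mul ENNReal.toReal_nonneg, ENNReal.ofReal_toReal (p.apply_ne_top a)]

end FiniteSupport

lemma tsum_pure_mul (a : α) (φ : α → ENNReal) : ∑' x, PMF.pure a x * φ x = φ a := by
  rw [tsum_eq_single a fun b hb => by simp [PMF.pure_apply, hb]]
  simp

lemma tsum_bind_mul (g : α → PMF β) (φ : β → ENNReal) :
    ∑' x, p.bind g x * φ x = ∑' a, p a * ∑' x, g a x * φ x := by
  simp only [PMF.bind_apply, ← ENNReal.tsum_mul_right, ← ENNReal.tsum_mul_left, mul_assoc]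
  exact ENNReal.tsum_comm

lemma tsum_map_mul (g : α → β) (φ : β → ENNReal) :
    ∑' x, p.map g x * φ x = ∑' a, p a * φ (g a) := by
  simp only [PMF.map, tsum_bind_mul, Function.comp_apply, tsum_pure_mul]

end Expectation

lemma GraphAlgorithm.tsum_run_mul {n : ℕ} (A : GraphAlgorithm n) (G : SimpleGraph (Fin n))
    {φ : A.State × ℕ → ENNReal} (hφ : ∀ c, ∑' x, A.step G c x * φ x = φ c) (t : ℕ) :
    ∑' x, A.run G t x * φ x = φ (A.start, 0) := by
  induction t with
  | zero => exact tsum_pure_mul _ _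
  | succ t ih => simp only [run, tsum_bind_mul, hφ, ih]

lemma graphOracle_support_finite {n : ℕ} (G : SimpleGraph (Fin n)) (q : GraphQuery n) :
    (graphOracle G q).support.Finite := by
  cases q with
  | indep U => exact (PMF.support_pure (α := Bool) _).symm ▸ Set.finite_singleton _
  | degree u => exact (PMF.support_pure (α := ℕ) _).symm ▸ Set.finite_singleton _
  | neighbor u => exact Set.toFinite (α := Option (Fin n)) _

/-- A randomized query algorithm as a well-founded decision tree: every execution is finite, and
the answers to the queries and the uniform internal random choices select the branch. -/
inductive QueryProg (n : ℕ) (α : Type) : Type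
  | ret (a : α)
  | query (q : GraphQuery n) (next : q.Answer → QueryProg n α)
  | toss (k : ℕ) (next : Fin (k + 1) → QueryProg n α)

namespace QueryProg

variable {n : ℕ} {α β : Type}

/-- The algorithm that executes a decision tree. Its states are the trees that remain to be
executed. -/
noncomputable abbrev toAlgorithm (p : QueryProg n ℝ) : GraphAlgorithm n where
  State := QueryProg n ℝ
  start := p
  act
    | ret a => .output a
    | query q next => .query q next
    | toss k next => .toss ((PMF.uniformOfFintype (Fin (k + 1))).map next)

/-- Sequential composition: run `p`, then the program selected by its output. -/
def bind : QueryProg n α → (α → QueryProg n β) → QueryProg n β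
  | ret a, f => f a
  | query q next, f => query q fun a => (next a).bind f
  | toss k next, f => toss k fun i => (next i).bind f

/-- The expected value of a function of the output of a program run on `G`. -/
noncomputable def mean (G : SimpleGraph (Fin n)) : QueryProg n α → (α → ℝ) → ℝ
  | ret a, f => f a
  | query q next, f => pmfMean (graphOracle G q) fun a => (next a).mean G f
  | toss k next, f => pmfMean (PMF.uniformOfFintype (Fin (k + 1))) fun i => (next i).mean G f

/-- The expected number of queries of a program run on `G`. -/
noncomputable def cost (G : SimpleGraph (Fin n)) : QueryProg n α → ℝ
  | ret _ => 0
  | query q next => 1 + pmfMean (graphOracle G q) fun a => (next a).cost G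
  | toss k next => pmfMean (PMF.uniformOfFintype (Fin (k + 1))) fun i => (next i).cost G

/-- The maximal number of steps, queries and internal moves alike, of a program run on `G`. Only
answers that occur with positive probability count, which makes the maximum finite. -/
noncomputable def depth (G : SimpleGraph (Fin n)) : QueryProg n α → ℕ
  | ret _ => 0
  | query q next => (graphOracle_support_finite G q).toFinset.sup (fun a => (next a).depth G) + 1
  | toss _ next => Finset.univ.sup (fun i => (next i).depth G) + 1

section Mean

variable (G : SimpleGraph (Fin n)) (p : QueryProg n α)

lemma uniform_support_finite (k : ℕ) : (PMF.uniformOfFintype (Fin (k + 1))).support.Finite :=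
  Set.toFinite _

lemma mean_add (f g : α → ℝ) : p.mean G (fun a => f a + g a) = p.mean G f + p.mean G g := by
  induction p with
  | ret a => rfl
  | query q next ih => simp only [mean, ih, pmfMean_add (graphOracle_support_finite G q)]
  | toss k next ih => simp only [mean, ih, pmfMean_add (uniform_support_finite k)]

lemma mean_const_mul (c : ℝ) (f : α → ℝ) : p.mean G (fun a => c * f a) = c * p.mean G f := by
  induction p with
  | ret a => rfl
  | query q next ih => simp only [mean, ih, pmfMean_const_mul]
  | toss k next ih => simp only [mean, ih, pmfMean_const_mul]

lemma mean_const (c : ℝ) : p.mean G (fun _ => c) = c := by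
  induction p with
  | ret a => rfl
  | query q next ih => simp only [mean, ih, pmfMean_const]
  | toss k next ih => simp only [mean, ih, pmfMean_const]

lemma mean_mono {f g : α → ℝ} (h : ∀ a, f a ≤ g a) : p.mean G f ≤ p.mean G g := by
  induction p with
  | ret a => exact h a
  | query q next ih => exact pmfMean_mono (graphOracle_support_finite G q) ih
  | toss k next ih => exact pmfMean_mono (uniform_support_finite k) ih

lemma mean_nonneg {f : α → ℝ} (h : ∀ a, 0 ≤ f a) : 0 ≤ p.mean G f := by
  simpa only [mean_const] using mean_mono G p h

lemma mean_bind (k : α → QueryProg n β) (f : β → ℝ) :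
    (p.bind k).mean G f = p.mean G fun a => (k a).mean G f := by
  induction p with
  | ret a => rfl
  | query q next ih => simp only [bind, mean, ih]
  | toss k next ih => simp only [bind, mean, ih]

lemma cost_nonneg : 0 ≤ p.cost G := by
  induction p with
  | ret _ => exact le_rfl
  | query q next ih => exact add_nonneg zero_le_one (pmfMean_nonneg _ ih)
  | toss k next ih => exact pmfMean_nonneg _ ih

lemma cost_bind (k : α → QueryProg n β) :
    (p.bind k).cost G = p.cost G + p.mean G fun a => (k a).cost G := by
  induction p with
  | ret _ => simp only [bind, mean, cost, zero_add]
  | query q next ih =>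
    simp only [bind, mean, cost, ih, pmfMean_add (graphOracle_support_finite G q), add_assoc]
  | toss k next ih => simp only [bind, mean, cost, ih, pmfMean_add (uniform_support_finite k)]

/-- The probability that the output of a program run on `G` lies in `S`. -/
noncomputable def prob (S : Set α) : ℝ := p.mean G (S.indicator 1)

lemma prob_nonneg (S : Set α) : 0 ≤ p.prob G S :=
  mean_nonneg G p fun _ => Set.indicator_nonneg (fun _ _ => zero_le_one) _

lemma prob_mono {S T : Set α} (h : S ⊆ T) : p.prob G S ≤ p.prob G T :=
  mean_mono G p fun _ => Set.indicator_le_indicator_of_subset h (fun _ => zero_le_one) _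

lemma prob_add_prob_compl (S : Set α) : p.prob G S + p.prob G Sᶜ = 1 := by
  rw [prob, prob, ← mean_add]
  simp only [← Pi.add_apply (S.indicator 1), Set.indicator_self_add_compl]
  exact mean_const G p 1

lemma prob_le_one (S : Set α) : p.prob G S ≤ 1 := by
  linarith [prob_add_prob_compl G p S, prob_nonneg G p Sᶜ]

end Mean

section Execution

variable (G : SimpleGraph (Fin n)) (p : QueryProg n ℝ)

lemma tsum_step_mul_ofReal_mean {f : ℝ → ℝ} (hf : ∀ r, 0 ≤ f r) (c : QueryProg n ℝ × ℕ) :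
    ∑' x : QueryProg n ℝ × ℕ, p.toAlgorithm.step G c x * ENNReal.ofReal (x.1.mean G f) =
      ENNReal.ofReal (c.1.mean G f) := by
  obtain ⟨c, j⟩ := c
  cases c with
  | ret a => exact tsum_pure_mul _ _
  | query q next =>
    exact (tsum_map_mul _ _ _).trans
      (tsum_mul_ofReal (graphOracle_support_finite G q) fun a => mean_nonneg G (next a) hf)
  | toss k next =>
    refine (tsum_map_mul _ _ _).trans ((tsum_map_mul _ _ _).trans ?_)
    exact tsum_mul_ofReal (uniform_support_finite k) fun i => mean_nonneg G (next i) hf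

lemma tsum_step_mul_ofReal_add_cost (c : QueryProg n ℝ × ℕ) :
    ∑' x : QueryProg n ℝ × ℕ, p.toAlgorithm.step G c x * ENNReal.ofReal (x.2 + x.1.cost G) =
      ENNReal.ofReal (c.2 + c.1.cost G) := by
  have hpos (i : ℕ) (r : QueryProg n ℝ) : 0 ≤ i + r.cost G :=
    add_nonneg i.cast_nonneg (cost_nonneg G r)
  obtain ⟨c, j⟩ := c
  cases c with
  | ret a => exact tsum_pure_mul _ _
  | query q next =>
    refine (tsum_map_mul _ _ _).trans ((tsum_mul_ofReal (graphOracle_support_finite G q)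
      fun a => hpos (j + 1) (next a)).trans ?_)
    rw [pmfMean_add (graphOracle_support_finite G q), pmfMean_const, cost, Nat.cast_succ, add_assoc]
  | toss k next =>
    refine (tsum_map_mul _ _ _).trans ((tsum_map_mul _ _ _).trans
      ((tsum_mul_ofReal (uniform_support_finite k) fun i => hpos j (next i)).trans ?_))
    rw [pmfMean_add (uniform_support_finite k), pmfMean_const, cost]

theorem expectedQueries_toAlgorithm_le :
    p.toAlgorithm.expectedQueries G ≤ ENNReal.ofReal (p.cost G) := by
  refine iSup_le fun t => ?_
  calc ∑' c : QueryProg n ℝ × ℕ, p.toAlgorithm.run G t c * (c.2 : ENNReal)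
      ≤ ∑' c : QueryProg n ℝ × ℕ, p.toAlgorithm.run G t c * ENNReal.ofReal (c.2 + c.1.cost G) := by
        gcongr with c
        rw [← ENNReal.ofReal_natCast]
        exact ENNReal.ofReal_le_ofReal (le_add_of_nonneg_right (cost_nonneg G c.1))
    _ = ENNReal.ofReal ((0 : ℕ) + p.cost G) :=
        p.toAlgorithm.tsum_run_mul G (tsum_step_mul_ofReal_add_cost G p) t
    _ = ENNReal.ofReal (p.cost G) := by rw [Nat.cast_zero, zero_add]

lemma depth_le_of_mem_support_step {c x : QueryProg n ℝ × ℕ}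
    (hx : x ∈ (p.toAlgorithm.step G c).support) : x.1.depth G ≤ c.1.depth G - 1 := by
  obtain ⟨c, j⟩ := c
  cases c with
  | ret a =>
    obtain rfl : x = (ret a, j) := by simpa [GraphAlgorithm.step] using hx
    exact Nat.zero_le _
  | query q next =>
    obtain ⟨a, ha, rfl⟩ : x ∈ (fun a => (next a, j + 1)) '' (graphOracle G q).support := by
      rwa [← PMF.support_map]
    exact Finset.le_sup (f := fun a => (next a).depth G)
      ((graphOracle_support_finite G q).mem_toFinset.mpr ha)
  | toss k next =>
    obtain ⟨-, ⟨i, -, rfl⟩, rfl⟩ : x ∈ (fun s => (s, j)) ''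
        (next '' (PMF.uniformOfFintype (Fin (k + 1))).support) := by
      rwa [← PMF.support_map, ← PMF.support_map]
    exact Finset.le_sup (f := fun i => (next i).depth G) (Finset.mem_univ i)

lemma depth_le_of_mem_support_run {t : ℕ} {x : QueryProg n ℝ × ℕ}
    (hx : x ∈ (p.toAlgorithm.run G t).support) : x.1.depth G ≤ p.depth G - t := by
  induction t generalizing x with
  | zero =>
    obtain rfl : x = (p, 0) := by simpa [GraphAlgorithm.run] using hx
    exact le_rfl
  | succ t ih =>
    obtain ⟨c, hc, hx⟩ := (PMF.mem_support_bind_iff _ _ _).mp hx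
    have hxc := depth_le_of_mem_support_step G p hx
    have := ih hc
    omega

theorem ofReal_prob_le_outputProb (S : Set ℝ) :
    ENNReal.ofReal (p.prob G S) ≤ p.toAlgorithm.outputProb G S := by
  refine le_iSup_of_le (p.depth G) ?_
  have hnn : ∀ r, 0 ≤ S.indicator (1 : ℝ → ℝ) r :=
    fun _ => Set.indicator_nonneg (fun _ _ => zero_le_one) _
  rw [prob, ← p.toAlgorithm.tsum_run_mul G (tsum_step_mul_ofReal_mean G p hnn) (p.depth G),
    PMF.toOuterMeasure_apply]
  refine ENNReal.tsum_le_tsum fun ⟨c, j⟩ => ?_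
  by_cases hc : (c, j) ∈ (p.toAlgorithm.run G (p.depth G)).support
  · have hdepth : c.depth G ≤ 0 := by
      simpa only [Nat.sub_self] using depth_le_of_mem_support_run G p hc
    cases c with
    | ret r =>
      by_cases hr : r ∈ S
      · have hmem : ((ret r, j) : QueryProg n ℝ × ℕ) ∈
            {x | ∃ s ∈ S, p.toAlgorithm.act x.1 = .output s} := ⟨r, hr, rfl⟩
        simp only [Set.indicator_of_mem hmem, mean, Set.indicator_of_mem hr, Pi.one_apply,
          ENNReal.ofReal_one, mul_one, le_refl]
      · simp only [mean, Set.indicator_of_notMem hr, ENNReal.ofReal_zero, mul_zero, zero_le]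
    | query q next => exact absurd hdepth (Nat.not_succ_le_zero _)
    | toss k next => exact absurd hdepth (Nat.not_succ_le_zero _)
  · rw [PMF.mem_support_iff, not_not] at hc
    simp only [hc, zero_mul, zero_le]

theorem outputProb_univ : p.toAlgorithm.outputProb G Set.univ = 1 := by
  refine le_antisymm (iSup_le fun t => ?_) ?_
  · rw [PMF.toOuterMeasure_apply, ← (p.toAlgorithm.run G t).tsum_coe]
    exact ENNReal.tsum_le_tsum fun x => Set.indicator_le_self _ _ _
  · have hone : p.prob G Set.univ = 1 := by
      rw [prob, Set.indicator_univ]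
      exact mean_const G p 1
    simpa only [hone, ENNReal.ofReal_one] using ofReal_prob_le_outputProb G p Set.univ

end Execution

end QueryProg

namespace QueryProg

variable {n : ℕ} {α β ι : Type} (G : SimpleGraph (Fin n))

section Combinators

/-- Run `p` and apply `f` to its output. -/
def map (f : α → β) (p : QueryProg n α) : QueryProg n β := p.bind fun a => ret (f a)

@[simp]
lemma mean_map (g : α → β) (p : QueryProg n α) (f : β → ℝ) :
    (p.map g).mean G f = p.mean G fun a => f (g a) :=
  mean_bind G p _ f

@[simp]
lemma cost_map (g : α → β) (p : QueryProg n α) : (p.map g).cost G = p.cost G := by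
  simp only [map, cost_bind, cost, mean_const, add_zero]

/-- The sum of the outputs of independent runs of `p` and `q`. -/
def add (p q : QueryProg n ℝ) : QueryProg n ℝ := p.bind fun x => q.map fun y => x + y

lemma cost_add (p q : QueryProg n ℝ) : (p.add q).cost G = p.cost G + q.cost G := by
  simp only [add, cost_bind, cost_map, mean_const]

/-- The sum of the outputs of independent runs of the programs `p i` for `i` in a list. -/
def sumOver (p : ι → QueryProg n ℝ) : List ι → QueryProg n ℝ
  | [] => ret 0
  | i :: l => (p i).add (sumOver p l)

lemma cost_sumOver (p : ι → QueryProg n ℝ) (l : List ι) :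
    (sumOver p l).cost G = (l.map fun i => (p i).cost G).sum := by
  induction l with
  | nil => rfl
  | cons i l ih => rw [sumOver, cost_add, ih, List.map_cons, List.sum_cons]

/-- The average of the outputs of `s` independent runs of `p`, which is `0` for `s = 0`. -/
noncomputable def average (s : ℕ) (p : QueryProg n ℝ) : QueryProg n ℝ :=
  (sumOver (fun _ => p) (List.range s)).map fun x => (s : ℝ)⁻¹ * x

lemma cost_average (s : ℕ) (p : QueryProg n ℝ) : (p.average s).cost G = s * p.cost G := by
  simp only [average, cost_map, cost_sumOver, List.map_const', List.length_range,
    List.sum_replicate, nsmul_eq_mul]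

/-- A uniformly random element of a finite type. -/
noncomputable def uniform (α : Type) [Fintype α] [Nonempty α] : QueryProg n α :=
  toss (Fintype.card α - 1) fun i => ret ((Fintype.equivFin α).symm
    (Fin.cast (Nat.sub_add_cancel Fintype.card_pos) i))

lemma mean_uniform [Fintype α] [Nonempty α] (f : α → ℝ) :
    (uniform α : QueryProg n α).mean G f = 𝔼 a, f a := by
  rw [uniform, mean, pmfMean_uniformOfFintype]
  exact Fintype.expect_equiv ((finCongr (Nat.sub_add_cancel Fintype.card_pos)).trans
    (Fintype.equivFin α).symm) _ _ fun i => rfl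

lemma cost_uniform [Fintype α] [Nonempty α] : (uniform α : QueryProg n α).cost G = 0 := by
  simp only [uniform, cost, pmfMean_const]

end Combinators

section Variance

variable (p q : QueryProg n ℝ)

/-- The variance of the output of a program run on `G`. -/
noncomputable def variance : ℝ := p.mean G fun x => (x - p.mean G id) ^ 2

lemma mean_id_const_mul (c : ℝ) : p.mean G (fun x => c * x) = c * p.mean G id :=
  mean_const_mul G p c id

lemma mean_sub_sq (c : ℝ) :
    p.mean G (fun x => (x - c) ^ 2) = p.variance G + (p.mean G id - c) ^ 2 := by
  have expand (d x : ℝ) : (x - d) ^ 2 = x ^ 2 + (-2 * d * x + d ^ 2) := by ring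
  simp only [variance, expand, mean_add, mean_const, mean_id_const_mul]
  ring

lemma variance_eq_mean_sq_sub_sq : p.variance G = p.mean G (fun x => x ^ 2) - p.mean G id ^ 2 := by
  have h := mean_sub_sq G p 0
  simp only [sub_zero] at h
  linarith

lemma variance_le_mean_sq : p.variance G ≤ p.mean G (fun x => x ^ 2) := by
  linarith [variance_eq_mean_sq_sub_sq G p, sq_nonneg (p.mean G id)]

lemma sq_mul_prob_le_variance {t : ℝ} {S : Set ℝ} (ht : 0 ≤ t)
    (hS : ∀ x ∈ S, t ≤ |x - p.mean G id|) : t ^ 2 * p.prob G S ≤ p.variance G := by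
  rw [prob, ← mean_const_mul]
  refine mean_mono G p fun x => ?_
  by_cases hx : x ∈ S
  · rw [Set.indicator_of_mem hx, Pi.one_apply, mul_one, ← sq_abs (x - _)]
    exact pow_le_pow_left₀ ht (hS x hx) 2
  · rw [Set.indicator_of_notMem hx, mul_zero]
    exact sq_nonneg _

lemma mean_id_map_mul (c : ℝ) : (p.map (c * ·)).mean G id = c * p.mean G id := by
  rw [mean_map]
  exact mean_id_const_mul G p c

lemma variance_map_mul (c : ℝ) : (p.map (c * ·)).variance G = c ^ 2 * p.variance G := by
  rw [variance, mean_id_map_mul, mean_map, variance]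
  simp only [← mul_sub, mul_pow, mean_const_mul]

lemma mean_id_add : (p.add q).mean G id = p.mean G id + q.mean G id := by
  have hq (x : ℝ) : q.mean G (fun y => x + y) = x + q.mean G id :=
    (mean_add G q (fun _ => x) id).trans (by rw [mean_const])
  simp only [add, mean_bind, mean_map, id_eq, hq]
  exact (mean_add G p id _).trans (by rw [mean_const])

lemma variance_add : (p.add q).variance G = p.variance G + q.variance G := by
  have hq (x : ℝ) : q.mean G (fun y => (x + y - (p.mean G id + q.mean G id)) ^ 2) =
      (x - p.mean G id) ^ 2 + q.variance G := by
    have shift (y : ℝ) : x + y - (p.mean G id + q.mean G id) =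
        y - (p.mean G id + q.mean G id - x) := by ring
    simp only [shift, mean_sub_sq]
    ring
  rw [variance, mean_id_add, add, mean_bind]
  simp only [mean_map, hq, mean_add, mean_const]
  rfl

lemma mean_id_sumOver (p : ι → QueryProg n ℝ) (l : List ι) :
    (sumOver p l).mean G id = (l.map fun i => (p i).mean G id).sum := by
  induction l with
  | nil => rfl
  | cons i l ih => rw [sumOver, mean_id_add, ih, List.map_cons, List.sum_cons]

lemma variance_sumOver (p : ι → QueryProg n ℝ) (l : List ι) :
    (sumOver p l).variance G = (l.map fun i => (p i).variance G).sum := by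
  induction l with
  | nil => exact (congrArg (· ^ 2) (sub_self (0 : ℝ))).trans (zero_pow two_ne_zero)
  | cons i l ih => rw [sumOver, variance_add, ih, List.map_cons, List.sum_cons]

lemma mean_id_average {s : ℕ} (hs : s ≠ 0) : (p.average s).mean G id = p.mean G id := by
  rw [average, mean_id_map_mul, mean_id_sumOver, List.map_const', List.length_range,
    List.sum_replicate, nsmul_eq_mul, inv_mul_cancel_left₀ (Nat.cast_ne_zero.mpr hs)]

lemma variance_average (s : ℕ) : (p.average s).variance G = p.variance G / s := by
  rw [average, variance_map_mul, variance_sumOver, List.map_const', List.length_range,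
    List.sum_replicate, nsmul_eq_mul, ← mul_assoc, inv_pow, sq, mul_inv, mul_assoc _ _ (s : ℝ)]
  rcases eq_or_ne (s : ℝ) 0 with hs | hs
  · simp only [hs, div_zero, inv_zero, zero_mul]
  · rw [inv_mul_cancel₀ hs, mul_one, inv_mul_eq_div]

end Variance

section Truncation

/-- Run a program, but abort and return `none` as soon as more than `T` queries are asked. -/
def trunc : ℕ → QueryProg n α → QueryProg n (Option α)
  | _, ret a => ret (some a)
  | 0, query _ _ => ret none
  | T + 1, query q next => query q fun a => (next a).trunc T
  | T, toss k next => toss k fun i => (next i).trunc T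

variable (T : ℕ) (p : QueryProg n α)

lemma cost_trunc_le : (p.trunc T).cost G ≤ T := by
  induction p generalizing T with
  | ret _ => exact T.cast_nonneg
  | query q next ih =>
    cases T with
    | zero => simp only [trunc, cost, Nat.cast_zero, le_refl]
    | succ T =>
      have h := pmfMean_mono (graphOracle_support_finite G q) fun a => ih a T
      rw [pmfMean_const] at h
      simp only [trunc, cost]
      push_cast
      linarith
  | toss k next ih =>
    have h := pmfMean_mono (uniform_support_finite k) fun i => ih i T
    rwa [pmfMean_const] at h

lemma prob_trunc_some_le (S : Set α) : (p.trunc T).prob G (some '' S) ≤ p.prob G S := by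
  induction p generalizing T with
  | ret a => exact (Set.indicator_image (Option.some_injective α)).le
  | query q next ih =>
    cases T with
    | zero =>
      refine le_of_eq_of_le (Set.indicator_of_notMem ?_ _) (prob_nonneg G _ S)
      exact fun ⟨_, _, h⟩ => Option.some_ne_none _ h
    | succ T => exact pmfMean_mono (graphOracle_support_finite G q) fun a => ih a T
  | toss k next ih => exact pmfMean_mono (uniform_support_finite k) fun i => ih i T

lemma succ_mul_prob_trunc_none_le : (T + 1) * (p.trunc T).prob G {none} ≤ p.cost G := by
  induction p generalizing T with
  | ret a =>
    have h : ((ret a).trunc T : QueryProg n (Option α)).prob G {none} = 0 :=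
      Set.indicator_of_notMem (s := {none}) (Option.some_ne_none a) _
    simp only [h, mul_zero, cost, le_refl]
  | query q next ih =>
    cases T with
    | zero =>
      have h := pmfMean_nonneg (graphOracle G q) fun a => cost_nonneg G (next a)
      simpa [prob, trunc, mean, cost] using h
    | succ T =>
      have h1 := pmfMean_mono (graphOracle_support_finite G q) fun a => ih a T
      have h2 := pmfMean_mono (graphOracle_support_finite G q) fun a =>
        prob_le_one G ((next a).trunc T) {none}
      rw [pmfMean_const_mul] at h1
      rw [pmfMean_const] at h2
      simp only [prob, trunc, mean, cost] at h1 h2 ⊢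
      push_cast
      linarith
  | toss k next ih =>
    have h := pmfMean_mono (uniform_support_finite k) fun i => ih i T
    rwa [pmfMean_const_mul] at h

end Truncation

section Queries

variable {G}

/-- Branch on whether a vertex set is independent. -/
def ifIndep (U : Finset (Fin n)) (p q : QueryProg n α) : QueryProg n α :=
  query (.indep U) fun b : Bool => if b then p else q

/-- Ask for the degree of a vertex. -/
def withDegree (u : Fin n) (k : ℕ → QueryProg n α) : QueryProg n α :=
  query (.degree u) fun d : ℕ => k d

/-- Ask for a random neighbor of a vertex. -/
def withNeighbor (u : Fin n) (k : Option (Fin n) → QueryProg n α) : QueryProg n α :=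
  query (.neighbor u) fun v : Option (Fin n) => k v

open Classical in
lemma mean_ifIndep (U : Finset (Fin n)) (p q : QueryProg n α) (f : α → ℝ) :
    (ifIndep U p q).mean G f = if G.IsIndepSet U then p.mean G f else q.mean G f :=
  (pmfMean_pure _ _).trans (by simp only [decide_eq_true_eq]; split_ifs <;> rfl)

open Classical in
lemma cost_ifIndep (U : Finset (Fin n)) (p q : QueryProg n α) :
    (ifIndep U p q).cost G = 1 + if G.IsIndepSet U then p.cost G else q.cost G :=
  congrArg (1 + ·) <| (pmfMean_pure _ _).trans (by simp only [decide_eq_true_eq]; split_ifs <;> rfl)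

open Classical in
lemma mean_withDegree (u : Fin n) (k : ℕ → QueryProg n α) (f : α → ℝ) :
    (withDegree u k).mean G f = (k (G.degree u)).mean G f :=
  pmfMean_pure _ _

open Classical in
lemma cost_withDegree (u : Fin n) (k : ℕ → QueryProg n α) :
    (withDegree u k).cost G = 1 + (k (G.degree u)).cost G :=
  congrArg (1 + ·) (pmfMean_pure _ _)

open Classical in
lemma mean_withNeighbor {u : Fin n} (hu : G.degree u ≠ 0) (k : Option (Fin n) → QueryProg n α)
    (f : α → ℝ) :
    (withNeighbor u k).mean G f = 𝔼 v ∈ G.neighborFinset u, (k (some v)).mean G f := by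
  have hne : (G.neighborFinset u).Nonempty :=
    Finset.card_ne_zero.mp ((G.card_neighborFinset_eq_degree u).trans_ne hu)
  rw [← pmfMean_uniformOfFinset hne,
    ← pmfMean_map_of_injective _ (Option.some_injective _) fun v => (k v).mean G f]
  exact congrArg (pmfMean · fun v => (k v).mean G f) (dif_pos hne)

lemma cost_withNeighbor_le (u : Fin n) (k : Option (Fin n) → QueryProg n α) {c : ℝ}
    (hk : ∀ v, (k v).cost G ≤ c) : (withNeighbor u k).cost G ≤ 1 + c := by
  have h := pmfMean_mono (graphOracle_support_finite G (.neighbor u)) hk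
  rw [pmfMean_const] at h
  exact add_le_add_right h 1

end Queries

section Deterministic

/-- Run on `G`, the program `p` outputs `a` with certainty and makes at most `c` queries in
expectation. -/
structure ReturnsWithin (p : QueryProg n α) (a : α) (c : ℝ) : Prop where
  mean_eq : ∀ f : α → ℝ, p.mean G f = f a
  cost_le : p.cost G ≤ c

namespace ReturnsWithin

variable {G} {p q : QueryProg n α} {a : α} {c d : ℝ}

lemma ret (a : α) : ReturnsWithin G (ret a) a 0 := ⟨fun _ => rfl, le_rfl⟩

lemma mono (hp : ReturnsWithin G p a c) (h : c ≤ d) : ReturnsWithin G p a d :=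
  ⟨hp.mean_eq, hp.cost_le.trans h⟩

lemma bind {k : α → QueryProg n β} {b : β} (hp : ReturnsWithin G p a c)
    (hk : ReturnsWithin G (k a) b d) : ReturnsWithin G (p.bind k) b (c + d) where
  mean_eq f := by rw [mean_bind, hp.mean_eq, hk.mean_eq]
  cost_le := by
    rw [cost_bind, hp.mean_eq]
    exact add_le_add hp.cost_le hk.cost_le

lemma map (f : α → β) (hp : ReturnsWithin G p a c) : ReturnsWithin G (p.map f) (f a) c where
  mean_eq g := by rw [mean_map, hp.mean_eq]
  cost_le := (cost_map G f p).trans_le hp.cost_le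

lemma add {p q : QueryProg n ℝ} {x y : ℝ} (hp : ReturnsWithin G p x c)
    (hq : ReturnsWithin G q y d) : ReturnsWithin G (p.add q) (x + y) (c + d) :=
  hp.bind (hq.map _)

lemma sumOver {p : ι → QueryProg n ℝ} {x c : ι → ℝ} {l : List ι}
    (h : ∀ i ∈ l, ReturnsWithin G (p i) (x i) (c i)) :
    ReturnsWithin G (sumOver p l) (l.map x).sum (l.map c).sum := by
  induction l with
  | nil => exact ret 0
  | cons i l ih =>
    rw [List.map_cons, List.sum_cons, List.map_cons, List.sum_cons]
    exact (h i List.mem_cons_self).add (ih fun j hj => h j (List.mem_cons_of_mem _ hj))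

lemma ifIndep_of_isIndepSet {U : Finset (Fin n)} (q : QueryProg n α) (hU : G.IsIndepSet U)
    (hp : ReturnsWithin G p a c) : ReturnsWithin G (ifIndep U p q) a (1 + c) where
  mean_eq f := by rw [mean_ifIndep, if_pos hU, hp.mean_eq]
  cost_le := by
    rw [cost_ifIndep, if_pos hU]
    exact add_le_add_right hp.cost_le 1

lemma ifIndep_of_not_isIndepSet {U : Finset (Fin n)} (p : QueryProg n α) (hU : ¬G.IsIndepSet U)
    (hq : ReturnsWithin G q a c) : ReturnsWithin G (ifIndep U p q) a (1 + c) where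
  mean_eq f := by rw [mean_ifIndep, if_neg hU, hq.mean_eq]
  cost_le := by
    rw [cost_ifIndep, if_neg hU]
    exact add_le_add_right hq.cost_le 1

open Classical in
lemma withDegree {u : Fin n} {k : ℕ → QueryProg n α}
    (hk : ReturnsWithin G (k (G.degree u)) a c) :
    ReturnsWithin G (withDegree u k) a (1 + c) where
  mean_eq f := by rw [mean_withDegree, hk.mean_eq]
  cost_le := by
    rw [cost_withDegree]
    exact add_le_add_right hk.cost_le 1

end ReturnsWithin

end Deterministic

end QueryProg

section EdgesWithin

variable {V : Type*} [DecidableEq V] {G : SimpleGraph V} {S T : Finset V}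

lemma isIndepSet_insert_iff {v : V} (hS : G.IsIndepSet S) :
    G.IsIndepSet (insert v S : Finset V) ↔ ∀ w ∈ S, ¬G.Adj v w := by
  rw [Finset.coe_insert, SimpleGraph.isIndepSet_iff, Set.pairwise_insert]
  exact ⟨fun ⟨_, h⟩ w hw hvw => (h w hw hvw.ne).1 hvw,
    fun h => ⟨hS, fun w hw _ => ⟨h w hw, fun hwv => h w hw hwv.symm⟩⟩⟩

lemma filter_adj_eq_nil_iff [DecidableRel G.Adj] {v : V} {l : List V}
    (hl : G.IsIndepSet (l.toFinset : Finset V)) :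
    l.filter (G.Adj v) = [] ↔ G.IsIndepSet (insert v l.toFinset : Finset V) := by
  simp only [isIndepSet_insert_iff hl, List.filter_eq_nil_iff, List.mem_toFinset,
    decide_eq_true_eq]

/-- The lists `J` and `R` arise from `I ++ l` by moving to `R` elements of `l` with a neighbor
in `J`, until `J` is independent. -/
structure IsGreedyExtension (G : SimpleGraph V) (I l J R : List V) : Prop where
  perm : (J ++ R).Perm (I ++ l)
  subset : I ⊆ J
  isIndepSet : G.IsIndepSet (J.toFinset : Finset V)
  exists_adj : ∀ v ∈ R, ∃ u ∈ J, G.Adj v u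

namespace IsGreedyExtension

variable {I l l₁ l₂ J J₁ J₂ R R₁ R₂ : List V}

lemma of_isIndepSet (h : G.IsIndepSet ((I ++ l).toFinset : Finset V)) :
    IsGreedyExtension G I l (I ++ l) [] where
  perm := by rw [List.append_nil]
  subset := List.subset_append_left I l
  isIndepSet := h
  exists_adj v hv := absurd hv List.not_mem_nil

lemma of_not_isIndepSet (hI : G.IsIndepSet (I.toFinset : Finset V)) (hl : l.length ≤ 1)
    (h : ¬G.IsIndepSet ((I ++ l).toFinset : Finset V)) : IsGreedyExtension G I l I l where
  perm := .refl _
  subset := List.Subset.refl I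
  isIndepSet := hI
  exists_adj v hv := by
    obtain ⟨v, rfl⟩ : ∃ v, l = [v] := List.length_eq_one_iff.mp
      (hl.antisymm (List.length_pos_of_mem hv))
    obtain rfl := List.mem_singleton.mp hv
    rw [List.toFinset_append, Finset.union_comm, List.toFinset_cons, List.toFinset_nil,
      Finset.insert_union, Finset.empty_union, isIndepSet_insert_iff hI] at h
    push Not at h
    simpa only [List.mem_toFinset] using h

lemma append (h₁ : IsGreedyExtension G I l₁ J₁ R₁) (h₂ : IsGreedyExtension G J₁ l₂ J₂ R₂) :
    IsGreedyExtension G I (l₁ ++ l₂) J₂ (R₁ ++ R₂) where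
  perm := by
    have hp₁ := List.perm_iff_count.mp h₁.perm
    have hp₂ := List.perm_iff_count.mp h₂.perm
    simp only [List.count_append] at hp₁ hp₂
    refine List.perm_iff_count.mpr fun a => ?_
    simp only [List.count_append]
    linarith [hp₁ a, hp₂ a]
  subset := List.Subset.trans h₁.subset h₂.subset
  isIndepSet := h₂.isIndepSet
  exists_adj v hv := by
    rcases List.mem_append.mp hv with hv | hv
    · obtain ⟨u, hu, huv⟩ := h₁.exists_adj v hv
      exact ⟨u, h₂.subset hu, huv⟩
    · exact h₂.exists_adj v hv

lemma ne_nil (h : IsGreedyExtension G I l J R) (hn : ¬G.IsIndepSet ((I ++ l).toFinset : Finset V)) :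
    R ≠ [] := by
  rintro rfl
  rw [← List.toFinset_eq_of_perm _ _ h.perm, List.append_nil] at hn
  exact hn h.isIndepSet

lemma length_lt (h : IsGreedyExtension G [] l J R) (hl : l ≠ []) : R.length < l.length := by
  have hlen := h.perm.length_eq
  rw [List.nil_append, List.length_append] at hlen
  have hpos := List.length_pos_of_ne_nil hl
  rcases R.eq_nil_or_concat' with rfl | ⟨R, v, rfl⟩
  · exact hpos
  · obtain ⟨u, hu, -⟩ := h.exists_adj v (by simp)
    have := List.length_pos_of_mem hu
    omega

lemma length_le_sum [DecidableRel G.Adj] (h : IsGreedyExtension G I l J R) :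
    R.length ≤ (R.map fun v => (J.filter (G.Adj v)).length).sum := by
  rw [← List.length_map (fun v => (J.filter (G.Adj v)).length)]
  refine List.length_le_sum_of_one_le _ fun a ha => ?_
  obtain ⟨v, hv, rfl⟩ := List.mem_map.mp ha
  obtain ⟨u, hu, huv⟩ := h.exists_adj v hv
  exact List.length_pos_of_mem (List.mem_filter.mpr ⟨hu, decide_eq_true huv⟩)

end IsGreedyExtension

variable (G) [DecidableRel G.Adj]

/-- The edges of `G` between the vertex `v` and the set `T`. -/
def edgesTo (v : V) (T : Finset V) : Finset (Sym2 V) :=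
  {w ∈ T | G.Adj v w}.image fun w => s(v, w)

@[simp]
lemma mem_edgesTo {v : V} {e : Sym2 V} :
    e ∈ edgesTo G v T ↔ ∃ w ∈ T, G.Adj v w ∧ s(v, w) = e := by
  simp only [edgesTo, Finset.mem_image, Finset.mem_filter, and_assoc]

lemma toFinset_map_filter_adj (v : V) (l : List V) :
    ((l.filter (G.Adj v)).map fun w => s(v, w)).toFinset = edgesTo G v l.toFinset := by
  ext e
  simp only [List.mem_toFinset, List.mem_map, List.mem_filter, decide_eq_true_eq, mem_edgesTo,
    and_assoc]

lemma card_edgesTo (v : V) : (edgesTo G v T).card = {w ∈ T | G.Adj v w}.card :=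
  Finset.card_image_of_injective _ fun _ _ => Sym2.congr_right.mp

variable [Fintype V]

/-- The edges of `G` with both endpoints in `S`. -/
def edgesWithin (S : Finset V) : Finset (Sym2 V) := {e ∈ G.edgeFinset | ∀ v ∈ e, v ∈ S}

@[simp]
lemma mk_mem_edgesWithin {u v : V} : s(u, v) ∈ edgesWithin G S ↔ G.Adj u v ∧ u ∈ S ∧ v ∈ S := by
  simp only [edgesWithin, Finset.mem_filter, SimpleGraph.mem_edgeFinset, SimpleGraph.mem_edgeSet,
    Sym2.ball]

lemma edgesWithin_univ : edgesWithin G Finset.univ = G.edgeFinset :=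
  Finset.filter_true_of_mem fun _ _ _ _ => Finset.mem_univ _

lemma edgesWithin_eq_empty_iff : edgesWithin G S = ∅ ↔ G.IsIndepSet S := by
  simp only [Finset.eq_empty_iff_forall_notMem, Sym2.forall, mk_mem_edgesWithin]
  exact ⟨fun h u hu v hv _ huv => h u v ⟨huv, hu, hv⟩,
    fun h u v ⟨huv, hu, hv⟩ => h hu hv huv.ne huv⟩

lemma edgesWithin_union_of_isIndepSet (hS : G.IsIndepSet S) :
    edgesWithin G (S ∪ T) = T.biUnion (edgesTo G · S) ∪ edgesWithin G T := by
  ext ⟨u, v⟩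
  simp only [mk_mem_edgesWithin, Finset.mem_union, Finset.mem_biUnion, mem_edgesTo]
  constructor
  · rintro ⟨huv, hu | hu, hv | hv⟩
    · exact absurd huv (hS hu hv huv.ne)
    · exact .inl ⟨v, hv, u, hu, huv.symm, Sym2.eq_swap⟩
    · exact .inl ⟨u, hu, v, hv, huv, rfl⟩
    · exact .inr ⟨huv, hu, hv⟩
  · rintro (⟨a, ha, b, hb, hab, h⟩ | ⟨huv, hu, hv⟩)
    · rcases Sym2.eq_iff.mp h with ⟨rfl, rfl⟩ | ⟨rfl, rfl⟩
      · exact ⟨hab, .inr ha, .inl hb⟩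
      · exact ⟨hab.symm, .inl hb, .inr ha⟩
    · exact ⟨huv, .inr hu, .inr hv⟩

lemma card_edgesWithin_union_of_isIndepSet (hS : G.IsIndepSet S) (hST : Disjoint S T) :
    (edgesWithin G (S ∪ T)).card =
      ∑ v ∈ T, {w ∈ S | G.Adj v w}.card + (edgesWithin G T).card := by
  rw [edgesWithin_union_of_isIndepSet G hS, Finset.card_union_of_disjoint, Finset.card_biUnion]
  · simp only [card_edgesTo]
  · intro v _ v' hv' hne
    simp only [Finset.disjoint_left, mem_edgesTo]
    rintro _ ⟨w, hw, -, rfl⟩ ⟨w', -, -, h⟩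
    rcases Sym2.eq_iff.mp h with ⟨h, -⟩ | ⟨h, -⟩
    · exact hne h.symm
    · exact Finset.disjoint_left.mp hST hw (h ▸ hv')
  · simp only [Finset.disjoint_left, Finset.mem_biUnion, mem_edgesTo]
    rintro _ ⟨v, -, w, hw, -, rfl⟩ h
    exact Finset.disjoint_left.mp hST hw ((mk_mem_edgesWithin G).mp h).2.2

lemma card_edgesWithin_append_of_isIndepSet {J R : List V} (h : (J ++ R).Nodup)
    (hJ : G.IsIndepSet (J.toFinset : Finset V)) :
    (edgesWithin G (J ++ R).toFinset).card =
      (R.map fun v => (J.filter (G.Adj v)).length).sum + (edgesWithin G R.toFinset).card := by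
  obtain ⟨hJnd, hRnd, hJR⟩ := List.nodup_append'.mp h
  rw [List.toFinset_append, card_edgesWithin_union_of_isIndepSet G hJ
    (List.disjoint_toFinset_iff_disjoint.mpr hJR), List.sum_toFinset _ hRnd]
  simp only [← List.toFinset_card_of_nodup (hJnd.filter _), List.toFinset_filter,
    decide_eq_true_eq]

end EdgesWithin

namespace QueryProg

variable {n : ℕ} (G : SimpleGraph (Fin n))

/-- Find by binary splitting the elements of the independent list `l` that are adjacent to `v`.
The argument `h` is the depth of the splitting, so `l` should have length at most `2 ^ h`. -/
def findNeighbors (v : Fin n) : ℕ → List (Fin n) → QueryProg n (List (Fin n))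
  | 0, l => ifIndep (insert v l.toFinset) (ret []) (ret l)
  | h + 1, l => ifIndep (insert v l.toFinset) (ret []) <|
      (findNeighbors v h (l.take (2 ^ h))).bind fun L =>
        (findNeighbors v h (l.drop (2 ^ h))).map fun L' => L ++ L'

lemma returnsWithin_findNeighbors_of_isIndepSet {v : Fin n} (h : ℕ) {l : List (Fin n)}
    (hn : G.IsIndepSet (insert v l.toFinset : Finset (Fin n))) :
    ReturnsWithin G (findNeighbors v h l) [] (1 + 0) := by
  cases h <;> exact (ReturnsWithin.ret []).ifIndep_of_isIndepSet _ hn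

open Classical in
lemma returnsWithin_findNeighbors (v : Fin n) (h : ℕ) {l : List (Fin n)} (hl : l.length ≤ 2 ^ h)
    (hI : G.IsIndepSet (l.toFinset : Finset (Fin n))) :
    ReturnsWithin G (findNeighbors v h l) (l.filter (G.Adj v))
      (1 + 2 * h * (l.filter (G.Adj v)).length) := by
  induction h generalizing l with
  | zero =>
    by_cases hn : G.IsIndepSet (insert v l.toFinset : Finset (Fin n))
    · rw [(filter_adj_eq_nil_iff hI).mpr hn]
      exact (returnsWithin_findNeighbors_of_isIndepSet G 0 hn).mono (by simp)
    have hne := (filter_adj_eq_nil_iff hI).not.mpr hn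
    have hself : l.filter (G.Adj v) = l :=
      List.filter_sublist.eq_of_length_le (hl.trans (List.length_pos_of_ne_nil hne))
    rw [hself]
    exact ((ReturnsWithin.ret l).ifIndep_of_not_isIndepSet _ hn).mono (by simp)
  | succ h ih =>
    by_cases hn : G.IsIndepSet (insert v l.toFinset : Finset (Fin n))
    · rw [(filter_adj_eq_nil_iff hI).mpr hn]
      exact (returnsWithin_findNeighbors_of_isIndepSet G (h + 1) hn).mono (by simp)
    have hlen : 0 < (l.filter (G.Adj v)).length :=
      List.length_pos_of_ne_nil ((filter_adj_eq_nil_iff hI).not.mpr hn)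
    have hmono {l' : List (Fin n)} (h : l' ⊆ l) : G.IsIndepSet (l'.toFinset : Finset (Fin n)) :=
      hI.mono fun x hx => List.mem_toFinset.mpr (h (List.mem_toFinset.mp hx))
    have htake := ih (List.length_take_le (2 ^ h) l) (hmono (List.take_subset _ _))
    have hdrop := ih (l := l.drop (2 ^ h)) (by rw [List.length_drop]; omega)
      (hmono (List.drop_subset _ _))
    have hboth := (htake.bind (k := fun L => (findNeighbors v h (l.drop (2 ^ h))).map (L ++ ·))
      (hdrop.map _)).ifIndep_of_not_isIndepSet (ret []) hn
    rw [← List.filter_append, List.take_append_drop] at hboth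
    refine hboth.mono ?_
    have hsplit := congrArg (fun l => (l.filter (G.Adj v)).length) (l.take_append_drop (2 ^ h))
    simp only [List.filter_append, List.length_append] at hsplit
    rw [← hsplit] at hlen ⊢
    push_cast
    have : (1 : ℝ) ≤ ((l.take (2 ^ h)).filter (G.Adj v)).length +
      ((l.drop (2 ^ h)).filter (G.Adj v)).length := mod_cast hlen
    linarith

/-- Extend the independent list `I` greedily, by binary splitting, by elements of `l`. The output
consists of the extension and of the rejected elements. The argument `h` is the depth of the
splitting, so `l` should have length at most `2 ^ h`. -/
def greedyIndep : ℕ → List (Fin n) → List (Fin n) → QueryProg n (List (Fin n) × List (Fin n))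
  | 0, I, l => ifIndep (I ++ l).toFinset (ret (I ++ l, [])) (ret (I, l))
  | h + 1, I, l => ifIndep (I ++ l).toFinset (ret (I ++ l, [])) <|
      (greedyIndep h I (l.take (2 ^ h))).bind fun x =>
        (greedyIndep h x.1 (l.drop (2 ^ h))).map fun y => (y.1, x.2 ++ y.2)

lemma returnsWithin_greedyIndep_of_isIndepSet (h : ℕ) {I l : List (Fin n)}
    (hn : G.IsIndepSet ((I ++ l).toFinset : Finset (Fin n))) :
    ReturnsWithin G (greedyIndep h I l) (I ++ l, []) (1 + 0) := by
  cases h <;> exact (ReturnsWithin.ret _).ifIndep_of_isIndepSet _ hn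

lemma exists_returnsWithin_greedyIndep (h : ℕ) {I l : List (Fin n)} (hl : l.length ≤ 2 ^ h)
    (hI : G.IsIndepSet (I.toFinset : Finset (Fin n))) :
    ∃ J R, IsGreedyExtension G I l J R ∧
      ReturnsWithin G (greedyIndep h I l) (J, R) (1 + 2 * h * R.length) := by
  induction h generalizing I l with
  | zero =>
    by_cases hn : G.IsIndepSet ((I ++ l).toFinset : Finset (Fin n))
    · exact ⟨_, _, .of_isIndepSet hn,
        (returnsWithin_greedyIndep_of_isIndepSet G 0 hn).mono (by simp)⟩
    · exact ⟨_, _, .of_not_isIndepSet hI (by simpa using hl) hn,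
        ((ReturnsWithin.ret _).ifIndep_of_not_isIndepSet _ hn).mono (by simp)⟩
  | succ h ih =>
    by_cases hn : G.IsIndepSet ((I ++ l).toFinset : Finset (Fin n))
    · exact ⟨_, _, .of_isIndepSet hn,
        (returnsWithin_greedyIndep_of_isIndepSet G (h + 1) hn).mono (by simp)⟩
    obtain ⟨J₁, R₁, hJ₁, hp₁⟩ := ih (List.length_take_le (2 ^ h) l) hI
    obtain ⟨J₂, R₂, hJ₂, hp₂⟩ := ih (l := l.drop (2 ^ h)) (by rw [List.length_drop]; omega)
      hJ₁.isIndepSet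
    have hJ := hJ₁.append hJ₂
    rw [List.take_append_drop] at hJ
    refine ⟨J₂, R₁ ++ R₂, hJ,
      ((hp₁.bind (hp₂.map _)).ifIndep_of_not_isIndepSet _ hn).mono ?_⟩
    have hlen : (1 : ℝ) ≤ R₁.length + R₂.length := by
      rw [← Nat.cast_add, ← List.length_append]
      exact_mod_cast List.length_pos_of_ne_nil (hJ.ne_nil hn)
    rw [List.length_append]
    push_cast
    linarith

/-- Run the programs `p i` for all `i` in a list and take the union of their outputs. -/
def unionOver {ι β : Type} [DecidableEq β] (p : ι → QueryProg n (Finset β)) :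
    List ι → QueryProg n (Finset β)
  | [] => ret ∅
  | i :: l => (p i).bind fun s => (unionOver p l).map fun t => s ∪ t

lemma ReturnsWithin.unionOver {ι β : Type} [DecidableEq ι] [DecidableEq β]
    {p : ι → QueryProg n (Finset β)} {s : ι → Finset β} {c : ι → ℝ} {l : List ι}
    (h : ∀ i ∈ l, ReturnsWithin G (p i) (s i) (c i)) :
    ReturnsWithin G (unionOver p l) (l.toFinset.biUnion s) (l.map c).sum := by
  induction l with
  | nil => exact ret ∅
  | cons i l ih =>
    rw [List.toFinset_cons, Finset.biUnion_insert, List.map_cons, List.sum_cons]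
    exact (h i List.mem_cons_self).bind ((ih fun j hj => h j (List.mem_cons_of_mem _ hj)).map _)

/-- Find all edges between the independent list `J` of length at most `2 ^ h` and the list `R`. -/
def findEdgesBetween (h : ℕ) (J R : List (Fin n)) : QueryProg n (Finset (Sym2 (Fin n))) :=
  unionOver (fun v => (findNeighbors v h J).map fun L => (L.map fun w => s(v, w)).toFinset) R

open Classical in
lemma returnsWithin_findEdgesBetween {h : ℕ} {J : List (Fin n)} (R : List (Fin n))
    (hJ : J.length ≤ 2 ^ h) (hI : G.IsIndepSet (J.toFinset : Finset (Fin n))) :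
    ReturnsWithin G (findEdgesBetween h J R) (R.toFinset.biUnion (edgesTo G · J.toFinset))
      (R.length + 2 * h * (R.map fun v => (J.filter (G.Adj v)).length).sum) := by
  have hunion := ReturnsWithin.unionOver G (l := R) fun v _ =>
    (returnsWithin_findNeighbors G v h hJ hI).map fun L => (L.map fun w => s(v, w)).toFinset
  simp only [toFinset_map_filter_adj] at hunion
  refine hunion.mono (le_of_eq ?_)
  rw [List.sum_map_add, List.sum_map_mul_left, Nat.cast_list_sum, List.map_map]
  simp [Function.comp_def]

/-- Find all edges between vertices in the list `l` of length at most `2 ^ h`: split `l` into an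
independent set and the vertices rejected by the greedy algorithm, find the edges between the two
parts, and recurse on the second one. The argument `k` bounds the number of rounds. -/
def findEdges (h : ℕ) : ℕ → List (Fin n) → QueryProg n (Finset (Sym2 (Fin n)))
  | 0, _ => ret ∅
  | k + 1, l => ifIndep l.toFinset (ret ∅) <| (greedyIndep h [] l).bind fun x =>
      (findEdgesBetween h x.1 x.2).bind fun E => (findEdges h k x.2).map fun E' => E ∪ E'

open Classical in
lemma returnsWithin_findEdges {h k : ℕ} {l : List (Fin n)} (hnd : l.Nodup) (hk : l.length ≤ k)
    (hl : l.length ≤ 2 ^ h) :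
    ReturnsWithin G (findEdges h k l) (edgesWithin G l.toFinset)
      (1 + (4 * h + 3) * (edgesWithin G l.toFinset).card) := by
  induction k generalizing l with
  | zero =>
    obtain rfl := List.eq_nil_of_length_eq_zero (Nat.le_zero.mp hk)
    rw [(edgesWithin_eq_empty_iff G).mpr (by simp)]
    exact (ReturnsWithin.ret ∅).mono (by positivity)
  | succ k ih =>
    by_cases hn : G.IsIndepSet (l.toFinset : Finset (Fin n))
    · rw [(edgesWithin_eq_empty_iff G).mpr hn]
      exact ((ReturnsWithin.ret ∅).ifIndep_of_isIndepSet _ hn).mono (by simp)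
    obtain ⟨J, R, hJ, hgreedy⟩ := exists_returnsWithin_greedyIndep G h (I := []) hl (by simp)
    have hlt := hJ.length_lt (by rintro rfl; simp at hn)
    have hperm : (J ++ R).Perm l := hJ.perm
    have hJR := hperm.nodup_iff.mpr hnd
    have hJh : J.length ≤ 2 ^ h := by
      have := hperm.length_eq
      rw [List.length_append] at this
      omega
    have hrest := ih hJR.of_append_right (by omega) (by omega)
    have hround := (returnsWithin_findEdgesBetween G R hJh hJ.isIndepSet).bind
      (k := fun E => (findEdges h k R).map (E ∪ ·)) (hrest.map _)
    have hrec := (hgreedy.bind (k := fun x => (findEdgesBetween h x.1 x.2).bind fun E =>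
      (findEdges h k x.2).map (E ∪ ·)) hround).ifIndep_of_not_isIndepSet (ret ∅) hn
    rw [← edgesWithin_union_of_isIndepSet G hJ.isIndepSet, ← List.toFinset_append] at hrec
    rw [← List.toFinset_eq_of_perm _ _ hperm]
    refine hrec.mono ?_
    rw [card_edgesWithin_append_of_isIndepSet G hJR hJ.isIndepSet]
    have hpos : (1 : ℝ) ≤ R.length := mod_cast List.length_pos_of_ne_nil (hJ.ne_nil hn)
    have hsum : (R.length : ℝ) ≤ (R.map fun v => (J.filter (G.Adj v)).length).sum :=
      mod_cast hJ.length_le_sum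
    rw [Nat.cast_add]
    nlinarith [mul_le_mul_of_nonneg_left hsum (h.cast_nonneg (α := ℝ))]

end QueryProg

section Coloring

variable {V : Type*} {N r : ℕ}

/-- The coloring `c` is constant on `T`, with value among the first `r` of the `N` colors. -/
def IsMono (r : ℕ) (c : V → Fin N) (T : Finset V) : Prop :=
  ∃ a : Fin N, a < r ∧ ∀ v ∈ T, c v = a

instance (c : V → Fin N) (T : Finset V) : Decidable (IsMono r c T) :=
  inferInstanceAs (Decidable (∃ a : Fin N, a < r ∧ ∀ v ∈ T, c v = a))

lemma ite_isMono (c : V → Fin N) {T : Finset V} (hT : T.Nonempty) :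
    (if IsMono r c T then (1 : ℝ) else 0) =
      ∑ a ∈ ({a | a < r} : Finset (Fin N)), ∏ v ∈ T, if c v = a then 1 else 0 := by
  obtain ⟨u, hu⟩ := hT
  simp only [Finset.prod_ite_zero, Finset.prod_const_one]
  rw [← Finset.natCast_card_filter, Finset.filter_filter]
  split_ifs with h
  · obtain ⟨a, ha, hca⟩ := h
    rw [Finset.card_eq_one.mpr ⟨a, ?_⟩, Nat.cast_one]
    refine Finset.eq_singleton_iff_unique_mem.mpr ⟨by simpa [ha] using hca, fun b hb => ?_⟩
    rw [← (Finset.mem_filter.mp hb).2.2 u hu, hca u hu]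
  · rw [Finset.filter_false_of_mem fun a _ ha => h ⟨a, ha⟩, Finset.card_empty, Nat.cast_zero]

variable [DecidableEq V]

lemma IsMono.union {c : V → Fin N} {T U : Finset V} (hT : IsMono r c T) (hU : IsMono r c U)
    (hTU : ¬Disjoint T U) : IsMono r c (T ∪ U) := by
  obtain ⟨v, hvT, hvU⟩ := Finset.not_disjoint_iff.mp hTU
  obtain ⟨a, ha, hca⟩ := hT
  obtain ⟨b, -, hcb⟩ := hU
  obtain rfl : a = b := (hca v hvT).symm.trans (hcb v hvU)
  exact ⟨a, ha, fun w hw => (Finset.mem_union.mp hw).elim (hca w) (hcb w)⟩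

lemma three_le_card_toFinset_union {e e' : Sym2 V} (he : ¬e.IsDiag) (he' : ¬e'.IsDiag)
    (hne : e ≠ e') : 3 ≤ (e.toFinset ∪ e'.toFinset).card := by
  have hcard := e.card_toFinset_of_not_isDiag he
  have hcard' := e'.card_toFinset_of_not_isDiag he'
  by_contra! hlt
  refine hne (Sym2.ext fun v => ?_)
  have hleft : e.toFinset = e.toFinset ∪ e'.toFinset :=
    Finset.eq_of_subset_of_card_le Finset.subset_union_left (by omega)
  have hright : e'.toFinset = e.toFinset ∪ e'.toFinset :=
    Finset.eq_of_subset_of_card_le Finset.subset_union_right (by omega)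
  rw [← Sym2.mem_toFinset, ← Sym2.mem_toFinset, hleft, ← hright]

/-- The number of edges in `L` that are monochromatic in one of the first `r` colors. -/
def monoCount (r : ℕ) (c : V → Fin N) (L : Finset (Sym2 V)) : ℕ :=
  Finset.card {e ∈ L | IsMono r c e.toFinset}

lemma monoCount_eq_sum [Fintype V] (c : V → Fin N) (L : Finset (Sym2 V)) :
    (monoCount r c L : ℝ) =
      ∑ a ∈ ({a | a < r} : Finset (Fin N)), (Finset.card {e ∈ L | ∀ v ∈ e, c v = a} : ℝ) := by
  simp only [monoCount, Finset.natCast_card_filter,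
    ite_isMono c (Finset.nonempty_iff_ne_empty.mpr (Sym2.toFinset_ne_empty _)),
    Finset.prod_ite_zero, Finset.prod_const_one, Sym2.mem_toFinset]
  exact Finset.sum_comm

variable [NeZero N]

lemma div_pow_three_sub_nonneg (hr : r ≤ N) : 0 ≤ (r : ℝ) / N ^ 3 - (r / N ^ 2) ^ 2 := by
  have hN : (N : ℝ) ≠ 0 := NeZero.ne _
  have hr' : (r : ℝ) ≤ N := mod_cast hr
  have h : (r : ℝ) / N ^ 3 - (r / N ^ 2) ^ 2 = r * (N - r) / N ^ 4 := by field_simp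
  rw [h]
  exact div_nonneg (mul_nonneg r.cast_nonneg (sub_nonneg.mpr hr')) (by positivity)

variable [Fintype V]

lemma expect_prod_ite_eq (T : Finset V) (f : V → Fin N) :
    𝔼 c : V → Fin N, ∏ v ∈ T, (if c v = f v then (1 : ℝ) else 0) = ((N : ℝ) ^ T.card)⁻¹ := by
  have hset : ({c | ∀ v ∈ T, c v = f v} : Finset (V → Fin N)) =
      Fintype.piFinset fun v => if v ∈ T then {f v} else Finset.univ := by
    ext c
    simp only [Finset.mem_filter, Finset.mem_univ, true_and, Fintype.mem_piFinset]
    exact forall_congr' fun v => by split_ifs with hv <;> simp [hv]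
  have hcard : Finset.card ({c | ∀ v ∈ T, c v = f v} : Finset (V → Fin N)) = N ^ Tᶜ.card := by
    simp [hset, apply_ite Finset.card, Finset.prod_ite, Finset.compl_eq_univ_sdiff,
      Finset.filter_notMem_eq_sdiff]
  simp only [Finset.prod_ite_zero, Finset.prod_const_one]
  rw [Fintype.expect_eq_sum_div_card, ← Finset.natCast_card_filter, hcard, Fintype.card_fun,
    Fintype.card_fin, ← Finset.card_add_card_compl T, pow_add, Nat.cast_mul, Nat.cast_pow,
    Nat.cast_pow, div_mul_cancel_right₀ (pow_ne_zero _ (NeZero.ne _))]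

lemma expect_isMono (hr : r ≤ N) {T : Finset V} (hT : T.Nonempty) :
    𝔼 c : V → Fin N, (if IsMono r c T then (1 : ℝ) else 0) = r / N ^ T.card := by
  simp only [ite_isMono _ hT, Finset.expect_sum_comm, expect_prod_ite_eq T fun _ => _,
    Finset.sum_const, Fin.card_filter_val_lt, min_eq_right hr, nsmul_eq_mul, div_eq_mul_inv]

lemma expect_isMono_mul_isMono_of_disjoint (hr : r ≤ N) {T U : Finset V} (hT : T.Nonempty)
    (hU : U.Nonempty) (hTU : Disjoint T U) :
    𝔼 c : V → Fin N, (if IsMono r c T then (1 : ℝ) else 0) * (if IsMono r c U then 1 else 0) =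
      r / N ^ T.card * (r / N ^ U.card) := by
  have hmul (c : V → Fin N) (a b : Fin N) :
      (∏ v ∈ T, if c v = a then (1 : ℝ) else 0) * (∏ v ∈ U, if c v = b then 1 else 0) =
        ∏ v ∈ T ∪ U, if c v = if v ∈ T then a else b then 1 else 0 := by
    rw [Finset.prod_union hTU]
    congr 1 <;> refine Finset.prod_congr rfl fun v hv => ?_
    · rw [if_pos hv]
    · rw [if_neg (Finset.disjoint_right.mp hTU hv)]
  simp only [ite_isMono _ hT, ite_isMono _ hU, Finset.sum_mul_sum, hmul, Finset.expect_sum_comm,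
    expect_prod_ite_eq, Finset.sum_const, Fin.card_filter_val_lt, min_eq_right hr, nsmul_eq_mul,
    Finset.card_union_of_disjoint hTU, pow_add, mul_inv, div_eq_mul_inv]
  ring

lemma expect_isMono_mul_isMono_le_of_not_disjoint (hr : r ≤ N) {T U : Finset V}
    (hTU : ¬Disjoint T U) :
    𝔼 c : V → Fin N, (if IsMono r c T then (1 : ℝ) else 0) * (if IsMono r c U then 1 else 0) ≤
      r / N ^ (T ∪ U).card := by
  obtain ⟨v, hvT, -⟩ := Finset.not_disjoint_iff.mp hTU
  rw [← expect_isMono hr ⟨v, Finset.mem_union_left U hvT⟩]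
  refine Finset.expect_le_expect fun c _ => ?_
  rw [ite_zero_mul_ite_zero, mul_one]
  split_ifs with h h'
  · exact le_rfl
  · exact absurd (h.1.union h.2 hTU) h'
  · exact zero_le_one
  · exact le_rfl

variable {L : Finset (Sym2 V)}

lemma expect_monoCount (hr : r ≤ N) (hL : ∀ e ∈ L, ¬e.IsDiag) :
    𝔼 c : V → Fin N, (monoCount r c L : ℝ) = r / N ^ 2 * L.card := by
  simp only [monoCount, Finset.natCast_card_filter, Finset.expect_sum_comm]
  rw [Finset.sum_congr rfl fun e he => (expect_isMono hr
    (Finset.nonempty_iff_ne_empty.mpr e.toFinset_ne_empty)).trans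
    (by rw [e.card_toFinset_of_not_isDiag (hL e he)]), Finset.sum_const, nsmul_eq_mul, mul_comm]

/-- Disjoint edges are monochromatic independently, so they do not contribute. -/
lemma expect_isMono_mul_isMono_sub_le (hr : r ≤ N) {e e' : Sym2 V} (he : ¬e.IsDiag)
    (he' : ¬e'.IsDiag) :
    𝔼 c : V → Fin N, (if IsMono r c e.toFinset then (1 : ℝ) else 0) *
        (if IsMono r c e'.toFinset then 1 else 0) - (r / N ^ 2) ^ 2 ≤
      (if e = e' then (r : ℝ) / N ^ 2 - (r / N ^ 2) ^ 2 else 0) +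
        if ¬Disjoint e.toFinset e'.toFinset then (r : ℝ) / N ^ 3 - (r / N ^ 2) ^ 2 else 0 := by
  have hγ := div_pow_three_sub_nonneg hr
  have hne (e : Sym2 V) : e.toFinset.Nonempty :=
    Finset.nonempty_iff_ne_empty.mpr e.toFinset_ne_empty
  have hcard := e.card_toFinset_of_not_isDiag he
  by_cases hdisj : Disjoint e.toFinset e'.toFinset
  · rw [expect_isMono_mul_isMono_of_disjoint hr (hne e) (hne e') hdisj, hcard,
      e'.card_toFinset_of_not_isDiag he', if_neg, if_neg (not_not.mpr hdisj), ← sq, sub_self,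
      add_zero]
    rintro rfl
    exact (hne e).ne_empty (disjoint_self.mp hdisj)
  have hle := expect_isMono_mul_isMono_le_of_not_disjoint hr hdisj
  rw [if_pos hdisj]
  split_ifs with heq
  · subst heq
    rw [Finset.union_self, hcard] at hle
    linarith
  · have hN : (1 : ℝ) ≤ N := mod_cast NeZero.one_le
    have hpow : (r : ℝ) / N ^ (e.toFinset ∪ e'.toFinset).card ≤ r / N ^ 3 := by
      gcongr
      exact three_le_card_toFinset_union he he' heq
    linarith

lemma expect_sq_monoCount_sub_le (hr : r ≤ N) (hL : ∀ e ∈ L, ¬e.IsDiag) {D : ℝ}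
    (hD : ∀ e ∈ L, (Finset.card {e' ∈ L | ¬Disjoint e.toFinset e'.toFinset} : ℝ) ≤ D) :
    𝔼 c : V → Fin N, ((monoCount r c L : ℝ) ^ 2) - (r / N ^ 2 * L.card) ^ 2 ≤
      ((r : ℝ) / N ^ 2 - (r / N ^ 2) ^ 2 + (r / N ^ 3 - (r / N ^ 2) ^ 2) * D) * L.card := by
  have hexpand : 𝔼 c : V → Fin N, ((monoCount r c L : ℝ) ^ 2) - (r / N ^ 2 * L.card) ^ 2 =
      ∑ e ∈ L, ∑ e' ∈ L, (𝔼 c : V → Fin N, (if IsMono r c e.toFinset then (1 : ℝ) else 0) *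
        (if IsMono r c e'.toFinset then 1 else 0) - (r / N ^ 2) ^ 2) := by
    simp only [monoCount, Finset.natCast_card_filter, sq, Finset.sum_mul_sum,
      Finset.expect_sum_comm, Finset.sum_sub_distrib, Finset.sum_const, nsmul_eq_mul]
    ring
  rw [hexpand, mul_comm _ (L.card : ℝ), ← nsmul_eq_mul]
  refine Finset.sum_le_card_nsmul _ _ _ fun e he => ?_
  refine (Finset.sum_le_sum fun e' he' =>
    expect_isMono_mul_isMono_sub_le hr (hL e he) (hL e' he')).trans ?_
  rw [Finset.sum_add_distrib, Finset.sum_ite_eq, if_pos he, ← Finset.sum_filter,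
    Finset.sum_const, nsmul_eq_mul, mul_comm (_ - _ : ℝ) D]
  gcongr
  exacts [div_pow_three_sub_nonneg hr, hD e he]

end Coloring

section LightEdges

variable {V : Type*} [Fintype V] [DecidableEq V] (G : SimpleGraph V) [DecidableRel G.Adj] (θ : ℝ)

/-- The edges of `G` with both endpoints of degree less than `θ`. -/
noncomputable def lightEdges : Finset (Sym2 V) :=
  {e ∈ G.edgeFinset | ∀ v ∈ e, (G.degree v : ℝ) < θ}

variable {G θ}

lemma not_isDiag_of_mem_lightEdges {e : Sym2 V} (he : e ∈ lightEdges G θ) : ¬e.IsDiag :=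
  G.not_isDiag_of_mem_edgeFinset (Finset.mem_of_mem_filter e he)

lemma card_lightEdges_not_disjoint_le {e : Sym2 V} (he : e ∈ lightEdges G θ) :
    (Finset.card {e' ∈ lightEdges G θ | ¬Disjoint e.toFinset e'.toFinset} : ℝ) ≤ 2 * θ := by
  induction e with | h u v
  obtain ⟨hu, hv⟩ := Sym2.ball.mp (Finset.mem_filter.mp he).2
  have hsub : {e' ∈ lightEdges G θ | ¬Disjoint s(u, v).toFinset e'.toFinset} ⊆
      G.incidenceFinset u ∪ G.incidenceFinset v := by
    intro e' he'
    simp only [lightEdges, Finset.mem_filter, Sym2.toFinset_mk_eq, Finset.disjoint_insert_left,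
      Finset.disjoint_singleton_left, Sym2.mem_toFinset] at he'
    simp only [Finset.mem_union, SimpleGraph.incidenceFinset_eq_filter, Finset.mem_filter]
    tauto
  have hcard : Finset.card {e' ∈ lightEdges G θ | ¬Disjoint s(u, v).toFinset e'.toFinset} ≤
      G.degree u + G.degree v := by
    rw [← G.card_incidenceFinset_eq_degree, ← G.card_incidenceFinset_eq_degree]
    exact (Finset.card_le_card hsub).trans (Finset.card_union_le _ _)
  have : (Finset.card {e' ∈ lightEdges G θ | ¬Disjoint s(u, v).toFinset e'.toFinset} : ℝ) ≤
      G.degree u + G.degree v := mod_cast hcard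
  linarith

lemma lightEdges_eq_edgeFinset (hθ : ∀ v, (G.degree v : ℝ) < θ) : lightEdges G θ = G.edgeFinset :=
  Finset.filter_true_of_mem fun _ _ v _ => hθ v

lemma card_lightEdges_le : (lightEdges G θ).card ≤ G.edgeFinset.card :=
  Finset.card_filter_le _ _

end LightEdges

namespace QueryProg

variable {n : ℕ} (G : SimpleGraph (Fin n)) (θ : ℝ)

/-- Determine whether both endpoints of `e` have degree less than `θ`. -/
noncomputable def lightIndicator (e : Sym2 (Fin n)) : QueryProg n ℝ :=
  withDegree e.out.1 fun d => withDegree e.out.2 fun d' =>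
    ret (if (d : ℝ) < θ ∧ (d' : ℝ) < θ then 1 else 0)

open Classical in
lemma returnsWithin_lightIndicator (e : Sym2 (Fin n)) :
    ReturnsWithin G (lightIndicator θ e)
      (if ∀ v ∈ e, (G.degree v : ℝ) < θ then 1 else 0) 2 := by
  have hball : (∀ v ∈ e, (G.degree v : ℝ) < θ) ↔
      (G.degree e.out.1 : ℝ) < θ ∧ (G.degree e.out.2 : ℝ) < θ := by
    conv_lhs => rw [← Quot.out_eq e]
    exact Sym2.ball
  rw [if_congr hball rfl rfl]
  exact (ReturnsWithin.withDegree (k := fun d => withDegree e.out.2 fun d' =>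
    ret (if (d : ℝ) < θ ∧ (d' : ℝ) < θ then 1 else 0))
    (ReturnsWithin.withDegree (.ret _))).mono (by norm_num)

/-- Count the edges between vertices in the list `l` of length at most `2 ^ h` whose endpoints have
degree less than `θ`. -/
noncomputable def countLightEdges (h : ℕ) (l : List (Fin n)) : QueryProg n ℝ :=
  (findEdges h l.length l).bind fun E => sumOver (lightIndicator θ) E.toList

open Classical in
lemma returnsWithin_countLightEdges {h : ℕ} {l : List (Fin n)} (hnd : l.Nodup)
    (hl : l.length ≤ 2 ^ h) :
    ReturnsWithin G (countLightEdges θ h l) (Finset.card {e ∈ lightEdges G θ | ∀ v ∈ e, v ∈ l})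
      (1 + (4 * h + 5) * Finset.card {e ∈ G.edgeFinset | ∀ v ∈ e, v ∈ l}) := by
  have hE : edgesWithin G l.toFinset = {e ∈ G.edgeFinset | ∀ v ∈ e, v ∈ l} := by
    simp only [edgesWithin, List.mem_toFinset]
  have hlight : {e ∈ lightEdges G θ | ∀ v ∈ e, v ∈ l} =
      {e ∈ edgesWithin G l.toFinset | ∀ v ∈ e, (G.degree v : ℝ) < θ} := by
    ext e
    simp only [hE, lightEdges, Finset.mem_filter]
    tauto
  have hsum := ReturnsWithin.sumOver (l := (edgesWithin G l.toFinset).toList)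
    fun e _ => returnsWithin_lightIndicator G θ e
  rw [Finset.sum_map_toList, Finset.sum_map_toList, ← Finset.natCast_card_filter, ← hlight,
    Finset.sum_const, nsmul_eq_mul] at hsum
  have hcount := (returnsWithin_findEdges G hnd le_rfl hl).bind
    (k := fun E => sumOver (lightIndicator θ) E.toList) hsum
  rw [← hE]
  exact hcount.mono (by linarith)

variable {N : ℕ}

/-- The vertices of color `a`. -/
def colorClass (c : Fin n → Fin N) (a : Fin N) : List (Fin n) :=
  (List.finRange n).filter fun v => c v = a

/-- Count the edges between vertices of degree less than `θ` that are monochromatic in one of the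
first `r` colors. -/
noncomputable def countMono (h r : ℕ) (c : Fin n → Fin N) : QueryProg n ℝ :=
  sumOver (fun a => countLightEdges θ h (colorClass c a)) ({a | a < r} : Finset (Fin N)).toList

open Classical in
lemma returnsWithin_countMono {h r : ℕ} (hn : n ≤ 2 ^ h) (hr : r ≤ N) (c : Fin n → Fin N) :
    ReturnsWithin G (countMono θ h r c) (monoCount r c (lightEdges G θ))
      (r + (4 * h + 5) * monoCount r c G.edgeFinset) := by
  have hlen (a : Fin N) : (colorClass c a).length ≤ n :=
    (List.length_filter_le _ _).trans List.length_finRange.le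
  have hnd (a : Fin N) : (colorClass c a).Nodup := (List.nodup_finRange n).filter _
  have hsum := ReturnsWithin.sumOver (l := ({a | a < r} : Finset (Fin N)).toList) fun a _ =>
    returnsWithin_countLightEdges G θ (hnd a) ((hlen a).trans hn)
  have hmem (a : Fin N) (v : Fin n) : v ∈ colorClass c a ↔ c v = a := by simp [colorClass]
  simp only [hmem, Finset.sum_map_toList, Finset.sum_add_distrib, ← Finset.mul_sum,
    Finset.sum_const, Fin.card_filter_val_lt, min_eq_right hr, nsmul_eq_mul, mul_one] at hsum
  rw [monoCount_eq_sum, monoCount_eq_sum]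
  convert hsum
  rfl

variable [NeZero N]

variable (n) in
/-- Color the vertices at random with `N` colors, count the edges between vertices of degree less
than `θ` that are monochromatic in one of the first `r` colors, and rescale by the inverse of the
probability `r / N ^ 2` that this happens to a given edge. -/
noncomputable def colorEst (h N : ℕ) [NeZero N] (r : ℕ) : QueryProg n ℝ :=
  ((uniform (Fin n → Fin N)).bind (countMono θ h r)).map fun x => ((r : ℝ) / N ^ 2)⁻¹ * x

variable {h r : ℕ}

open Classical in
lemma mean_countMono_uniform (hn : n ≤ 2 ^ h) (hr : r ≤ N) (f : ℝ → ℝ) :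
    ((uniform (Fin n → Fin N)).bind (countMono θ h r)).mean G f =
      𝔼 c : Fin n → Fin N, f (monoCount r c (lightEdges G θ)) := by
  rw [mean_bind, mean_uniform]
  exact Finset.expect_congr rfl fun c _ => (returnsWithin_countMono G θ hn hr c).mean_eq f

open Classical in
lemma mean_id_colorEst (hn : n ≤ 2 ^ h) (hr : r ≤ N) (hr0 : r ≠ 0) :
    (colorEst n θ h N r).mean G id = (lightEdges G θ).card := by
  have hN : (N : ℝ) ≠ 0 := NeZero.ne _
  have hr0' : (r : ℝ) ≠ 0 := Nat.cast_ne_zero.mpr hr0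
  rw [colorEst, mean_id_map_mul, mean_countMono_uniform G θ hn hr]
  simp only [id_eq]
  rw [expect_monoCount hr fun _ => not_isDiag_of_mem_lightEdges,
    inv_mul_cancel_left₀ (div_ne_zero hr0' (pow_ne_zero 2 hN))]

open Classical in
lemma cost_colorEst_le (hn : n ≤ 2 ^ h) (hr : r ≤ N) :
    (colorEst n θ h N r).cost G ≤ r + (4 * h + 5) * (r / N ^ 2 * G.edgeFinset.card) := by
  rw [colorEst, cost_map, cost_bind, cost_uniform, mean_uniform, zero_add]
  refine (Finset.expect_le_expect fun c _ =>
    (returnsWithin_countMono G θ hn hr c).cost_le).trans_eq ?_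
  rw [Finset.expect_add_distrib, Fintype.expect_const, ← Finset.mul_expect,
    expect_monoCount hr fun _ => G.not_isDiag_of_mem_edgeFinset]

open Classical in
lemma variance_colorEst_le (hn : n ≤ 2 ^ h) (hr : r ≤ N) (hr0 : r ≠ 0) (hθ : 0 ≤ θ) :
    (colorEst n θ h N r).variance G ≤
      ((N : ℝ) ^ 2 / r - 1 + 2 * (N / r - 1) * θ) * G.edgeFinset.card := by
  have hN : (1 : ℝ) ≤ N := mod_cast NeZero.one_le
  have hr1 : (0 : ℝ) < r := mod_cast Nat.pos_of_ne_zero hr0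
  have hrN : (r : ℝ) ≤ N := mod_cast hr
  have hvar := expect_sq_monoCount_sub_le hr (fun _ => not_isDiag_of_mem_lightEdges)
    fun e he => card_lightEdges_not_disjoint_le (G := G) (θ := θ) he
  rw [colorEst, variance_map_mul, variance_eq_mean_sq_sub_sq, mean_countMono_uniform G θ hn hr,
    mean_countMono_uniform G θ hn hr]
  simp only [id_eq]
  rw [expect_monoCount hr fun _ => not_isDiag_of_mem_lightEdges]
  have hfactor : 0 ≤ (N : ℝ) ^ 2 / r - 1 + 2 * (N / r - 1) * θ := by
    have h1 : 1 ≤ (N : ℝ) / r := by rwa [one_le_div hr1]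
    have h2 : 1 ≤ (N : ℝ) ^ 2 / r := by
      rw [one_le_div hr1]
      nlinarith
    nlinarith [mul_nonneg (sub_nonneg.mpr h1) hθ]
  calc _ ≤ ((r : ℝ) / N ^ 2)⁻¹ ^ 2 * _ := mul_le_mul_of_nonneg_left hvar (sq_nonneg _)
    _ = ((N : ℝ) ^ 2 / r - 1 + 2 * (N / r - 1) * θ) * (lightEdges G θ).card := by
      field_simp
    _ ≤ _ := mul_le_mul_of_nonneg_left (mod_cast card_lightEdges_le) hfactor

end QueryProg

section HighDegree

variable {V : Type*} [Fintype V] (G : SimpleGraph V) [DecidableRel G.Adj] (θ : ℝ)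

lemma sum_sum_neighborFinset {M : Type*} [AddCommMonoid M] {f : V → V → M}
    {g : Sym2 V → M} (hfg : ∀ u v, G.Adj u v → f u v + f v u = g s(u, v)) :
    ∑ u, ∑ v ∈ G.neighborFinset u, f u v = ∑ e ∈ G.edgeFinset, g e := by
  classical
  have hdart : ∑ u, ∑ v ∈ G.neighborFinset u, f u v = ∑ d : G.Dart, f d.fst d.snd := by
    rw [Finset.sum_sigma']
    exact Finset.sum_bij' (fun p hp => ⟨(p.1, p.2), by simpa using hp⟩)
      (fun d _ => ⟨d.fst, d.snd⟩) (by simp) (by simp)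
      (fun _ _ => rfl) (fun _ _ => rfl) (fun _ _ => rfl)
  rw [hdart, ← Finset.sum_fiberwise_of_maps_to (t := G.edgeFinset) (g := SimpleGraph.Dart.edge)
    fun d _ => SimpleGraph.mem_edgeFinset.mpr d.edge_mem]
  refine Finset.sum_congr rfl fun e he => ?_
  induction e with | h u v
  have huv : G.Adj u v := SimpleGraph.mem_edgeFinset.mp he
  let d : G.Dart := ⟨(u, v), huv⟩
  rw [show s(u, v) = d.edge from rfl, d.edge_fiber, Finset.sum_pair d.symm_ne.symm]
  exact hfg u v huv

/-- The number of neighbors of `u` of degree at least `θ`. -/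
noncomputable def highDegree (u : V) : ℕ := Finset.card {v ∈ G.neighborFinset u | θ ≤ G.degree v}

/-- The weight that a vertex of degree `d` gives to its neighbors of degree at least `θ`. An
edge whose endpoints both have degree at least `θ` is counted from both sides. -/
noncomputable def halfWeight (d : ℕ) : ℝ := if (d : ℝ) < θ then 1 else 1 / 2

lemma halfWeight_nonneg (d : ℕ) : 0 ≤ halfWeight θ d := by
  unfold halfWeight
  split_ifs <;> norm_num

lemma halfWeight_le_one (d : ℕ) : halfWeight θ d ≤ 1 := by
  unfold halfWeight
  split_ifs <;> norm_num

lemma highDegree_le_degree (u : V) : highDegree G θ u ≤ G.degree u := Finset.card_filter_le _ _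

lemma card_lightEdges_add_sum_highDegree [DecidableEq V] :
    (lightEdges G θ).card + ∑ u, halfWeight θ (G.degree u) * highDegree G θ u =
      G.edgeFinset.card := by
  have hterm (u v : V) (_ : G.Adj u v) :
      halfWeight θ (G.degree u) * (if θ ≤ G.degree v then 1 else 0) +
        halfWeight θ (G.degree v) * (if θ ≤ G.degree u then 1 else 0) =
      1 - if ∀ w ∈ s(u, v), (G.degree w : ℝ) < θ then 1 else 0 := by
    simp only [halfWeight, ← not_lt, Sym2.ball]
    split_ifs <;> first | tauto | norm_num
  simp only [highDegree, Finset.natCast_card_filter, Finset.mul_sum]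
  rw [sum_sum_neighborFinset G
    (g := fun e => 1 - if ∀ w ∈ e, (G.degree w : ℝ) < θ then 1 else 0) hterm,
    Finset.sum_sub_distrib, ← Finset.natCast_card_filter, Finset.sum_const, nsmul_one, lightEdges,
    add_sub_cancel]

lemma sum_highDegree_le : ∑ u, highDegree G θ u ≤ 2 * G.edgeFinset.card := by
  classical
  exact (Finset.sum_le_sum fun u _ => highDegree_le_degree G θ u).trans_eq
    G.sum_degrees_eq_twice_card_edges

lemma mul_highDegree_le (u : V) : θ * highDegree G θ u ≤ 2 * G.edgeFinset.card := by
  classical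
  calc θ * highDegree G θ u
      = ∑ v ∈ G.neighborFinset u with θ ≤ G.degree v, θ := by
        rw [Finset.sum_const, nsmul_eq_mul, mul_comm, highDegree]
    _ ≤ ∑ v ∈ G.neighborFinset u with θ ≤ G.degree v, (G.degree v : ℝ) :=
        Finset.sum_le_sum fun v hv => (Finset.mem_filter.mp hv).2
    _ ≤ ∑ v, (G.degree v : ℝ) :=
        Finset.sum_le_univ_sum_of_nonneg fun v => Nat.cast_nonneg _
    _ = 2 * G.edgeFinset.card := mod_cast G.sum_degrees_eq_twice_card_edges

end HighDegree

namespace QueryProg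

variable {n : ℕ} (G : SimpleGraph (Fin n)) (θ : ℝ)

/-- Determine whether a random neighbor of `u` has degree at least `θ`. -/
noncomputable def probe (u : Fin n) : QueryProg n ℝ :=
  withNeighbor u fun o => o.elim (ret 0) fun v =>
    withDegree v fun d => ret (if θ ≤ d then 1 else 0)

lemma cost_probe_le (u : Fin n) : (probe θ u).cost G ≤ 2 := by
  refine (cost_withNeighbor_le u _ (c := 1) ?_).trans_eq one_add_one_eq_two
  rintro (_ | v) <;> simp [cost_withDegree, cost]

open Classical in
lemma mean_probe {u : Fin n} (hu : G.degree u ≠ 0) {f : ℝ → ℝ} (hf0 : f 0 = 0) (hf1 : f 1 = 1) :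
    (probe θ u).mean G f = highDegree G θ u / G.degree u := by
  rw [probe, mean_withNeighbor hu]
  simp only [Option.elim_some, mean_withDegree, mean, apply_ite f, hf0, hf1]
  rw [Finset.expect_eq_sum_div_card, ← Finset.natCast_card_filter, highDegree,
    SimpleGraph.card_neighborFinset_eq_degree]

/-- Estimate the number of neighbors of `u` of degree at least `θ`, weighted by `halfWeight θ`. The
number of probes grows with the degree of `u`, which keeps the variance proportional to `B`. -/
noncomputable def neighborhoodEst (B : ℕ) (u : Fin n) : QueryProg n ℝ :=
  withDegree u fun d => if d = 0 then ret 0 else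
    ((probe θ u).average (d / B + 1)).map fun x => halfWeight θ d * d * x

variable {B : ℕ}

open Classical in
lemma mean_id_neighborhoodEst (u : Fin n) :
    (neighborhoodEst θ B u).mean G id = halfWeight θ (G.degree u) * highDegree G θ u := by
  rw [neighborhoodEst, mean_withDegree]
  split_ifs with hu
  · simp [mean, Nat.le_zero.mp (hu ▸ highDegree_le_degree G θ u)]
  · rw [mean_id_map_mul, mean_id_average _ _ (Nat.succ_ne_zero _), mean_probe G θ hu rfl rfl,
      mul_assoc, mul_div_cancel₀ _ (Nat.cast_ne_zero.mpr hu)]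

open Classical in
lemma mean_sq_average_probe_le {u : Fin n} (hu : G.degree u ≠ 0) {s : ℕ} (hs : s ≠ 0) :
    ((probe θ u).average s).mean G (fun x => x ^ 2) ≤
      highDegree G θ u / G.degree u / s + (highDegree G θ u / G.degree u) ^ 2 := by
  have hvar := variance_eq_mean_sq_sub_sq G ((probe θ u).average s)
  have hprobe := variance_le_mean_sq G (probe θ u)
  rw [mean_probe G θ hu (f := fun x => x ^ 2) (zero_pow two_ne_zero) (one_pow 2)] at hprobe
  rw [variance_average, mean_id_average _ _ hs, mean_probe G θ hu rfl rfl] at hvar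
  rw [← sub_le_iff_le_add, ← hvar]
  gcongr

open Classical in
lemma mean_sq_neighborhoodEst_le (hB : 0 < B) (u : Fin n) :
    (neighborhoodEst θ B u).mean G (fun x => x ^ 2) ≤
      (B + highDegree G θ u) * highDegree G θ u := by
  rw [neighborhoodEst, mean_withDegree]
  split_ifs with hu
  · simp only [mean, zero_pow two_ne_zero]
    positivity
  rw [mean_map]
  simp only [mul_pow, mean_const_mul]
  have hsq := mean_sq_average_probe_le G θ hu (Nat.succ_ne_zero (G.degree u / B))
  have hweight := pow_le_one₀ (n := 2) (halfWeight_nonneg θ (G.degree u)) (halfWeight_le_one θ _)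
  have _hd : 0 < (G.degree u : ℝ) := mod_cast Nat.pos_of_ne_zero hu
  have hprobes : (G.degree u : ℝ) / (G.degree u / B + 1 : ℕ) ≤ B := by
    rw [div_le_iff₀ (by positivity)]
    exact_mod_cast (Nat.lt_mul_div_succ (G.degree u) hB).le
  calc _ ≤ 1 * (G.degree u : ℝ) ^ 2 * (highDegree G θ u / G.degree u / (G.degree u / B + 1 : ℕ) +
        (highDegree G θ u / G.degree u) ^ 2) := by
        gcongr
        exact mean_nonneg G _ fun _ => sq_nonneg _
    _ = (G.degree u / (G.degree u / B + 1 : ℕ) + highDegree G θ u) * highDegree G θ u := by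
        field_simp
    _ ≤ _ := by gcongr

open Classical in
lemma cost_neighborhoodEst_le (u : Fin n) :
    (neighborhoodEst θ B u).cost G ≤ 3 + 2 / B * G.degree u := by
  rw [neighborhoodEst, cost_withDegree]
  split_ifs with hu
  · rw [hu, cost]
    norm_num
  · rw [cost_map, cost_average]
    have hprobes : ((G.degree u / B + 1 : ℕ) : ℝ) ≤ G.degree u / B + 1 := by
      push_cast
      gcongr
      exact Nat.cast_div_le
    have hcost := mul_le_mul hprobes (cost_probe_le G θ u) (cost_nonneg G _) (by positivity)
    linear_combination hcost

/-- One sample of the estimator for the number of edges with an endpoint of degree at least `θ`. -/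
noncomputable def sample [NeZero n] (B : ℕ) : QueryProg n ℝ :=
  ((uniform (Fin n)).bind (neighborhoodEst θ B)).map fun x => n * x

variable [NeZero n]

lemma mean_neighborhoodEst_uniform (f : ℝ → ℝ) :
    n * ((uniform (Fin n)).bind (neighborhoodEst θ B)).mean G f =
      ∑ u, (neighborhoodEst θ B u).mean G f := by
  rw [mean_bind, mean_uniform, Fintype.expect_eq_sum_div_card, Fintype.card_fin,
    mul_div_cancel₀ _ (NeZero.ne _)]

open Classical in
lemma mean_id_sample :
    (sample θ B).mean G id = G.edgeFinset.card - (lightEdges G θ).card := by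
  rw [sample, mean_id_map_mul, mean_neighborhoodEst_uniform,
    Finset.sum_congr rfl fun u _ => mean_id_neighborhoodEst G θ u, eq_sub_iff_add_eq',
    card_lightEdges_add_sum_highDegree]

open Classical in
lemma mean_sq_sample_le (hθ : 0 < θ) (hB : 0 < B) :
    (sample θ B).mean G (fun x => x ^ 2) ≤
      n * (2 * G.edgeFinset.card) * (B + 2 * G.edgeFinset.card / θ) := by
  rw [sample, mean_map]
  simp only [mul_pow, mean_const_mul]
  rw [sq, mul_assoc, mean_neighborhoodEst_uniform, mul_assoc]
  gcongr
  calc _ ≤ ∑ u, (B + 2 * G.edgeFinset.card / θ : ℝ) * highDegree G θ u := by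
        refine Finset.sum_le_sum fun u _ => (mean_sq_neighborhoodEst_le G θ hB u).trans ?_
        gcongr
        rw [le_div_iff₀' hθ]
        exact mul_highDegree_le G θ u
    _ ≤ (B + 2 * G.edgeFinset.card / θ) * (2 * G.edgeFinset.card) := by
        rw [← Finset.mul_sum]
        gcongr
        exact_mod_cast sum_highDegree_le G θ
    _ = _ := mul_comm _ _

open Classical in
lemma cost_sample_le :
    (sample θ B).cost G ≤ 3 + 4 * G.edgeFinset.card / (n * B) := by
  have hn : (n : ℝ) ≠ 0 := NeZero.ne _
  rw [sample, cost_map, cost_bind, cost_uniform, mean_uniform, zero_add]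
  refine (Finset.expect_le_expect fun u _ => cost_neighborhoodEst_le G θ u).trans_eq ?_
  rw [Finset.expect_add_distrib, Fintype.expect_const, ← Finset.mul_expect,
    Fintype.expect_eq_sum_div_card, Fintype.card_fin, ← Nat.cast_sum,
    G.sum_degrees_eq_twice_card_edges]
  push_cast
  field_simp
  ring

end QueryProg

namespace QueryProg

variable {n : ℕ} (G : SimpleGraph (Fin n)) {ε : ℝ} {h b β : ℕ}

/-- The number of colors of the coloring estimator at the guess `β ^ 2` for the number `m` of edges.
It keeps the variance at most `ε ^ 2 * β ^ 2 * m / 20000`. -/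
noncomputable def numColors (ε : ℝ) (β : ℕ) : ℕ := max 1 (min β ⌈ε ^ 2 * β ^ 2 / 20000⌉₊)

instance (ε : ℝ) (β : ℕ) : NeZero (numColors ε β) :=
  ⟨(lt_of_lt_of_le one_pos (le_max_left _ _)).ne'⟩

lemma numColors_sub_one_le (ε : ℝ) (β : ℕ) : (numColors ε β : ℝ) - 1 ≤ ε ^ 2 * β ^ 2 / 20000 := by
  have hceil := (Nat.ceil_lt_add_one (show 0 ≤ ε ^ 2 * (β : ℝ) ^ 2 / 20000 by positivity)).le
  rw [sub_le_iff_le_add, numColors, Nat.cast_max, Nat.cast_one]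
  refine max_le (le_add_of_nonneg_left (by positivity)) (le_trans ?_ hceil)
  exact_mod_cast min_le_right _ _

lemma inv_numColors_le (hε : 0 < ε) (hβ : 0 < β) :
    (numColors ε β : ℝ)⁻¹ ≤ (β + 20000 / ε ^ 2) / β ^ 2 := by
  have hmin : min (β : ℝ) (ε ^ 2 * β ^ 2 / 20000) ≤ numColors ε β := by
    refine (min_le_min_left _ (Nat.le_ceil _)).trans ?_
    rw [← Nat.cast_min, Nat.cast_le]
    exact le_max_right _ _
  calc (numColors ε β : ℝ)⁻¹ ≤ (min (β : ℝ) (ε ^ 2 * β ^ 2 / 20000))⁻¹ := by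
        gcongr
    _ ≤ (β : ℝ)⁻¹ + (ε ^ 2 * β ^ 2 / 20000)⁻¹ := by
        rcases min_choice (β : ℝ) (ε ^ 2 * β ^ 2 / 20000) with hmin | hmin <;> rw [hmin]
        · exact le_add_of_nonneg_right (by positivity)
        · exact le_add_of_nonneg_left (by positivity)
    _ = (β + 20000 / ε ^ 2) / β ^ 2 := by
        field_simp

variable (n) in
/-- The estimator that counts all monochromatic edges. -/
noncomputable def fullEst (ε : ℝ) (h β : ℕ) : QueryProg n ℝ :=
  colorEst n n h (numColors ε β) (numColors ε β)

open Classical in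
lemma mean_id_fullEst (hn : n ≤ 2 ^ h) : (fullEst n ε h β).mean G id = G.edgeFinset.card := by
  rw [fullEst, mean_id_colorEst G n hn le_rfl (NeZero.ne _), lightEdges_eq_edgeFinset]
  exact fun v => Nat.cast_lt.mpr ((G.degree_lt_card_verts v).trans_eq (Fintype.card_fin n))

open Classical in
lemma variance_fullEst_le (hn : n ≤ 2 ^ h) :
    (fullEst n ε h β).variance G ≤ ε ^ 2 * β ^ 2 / 20000 * G.edgeFinset.card := by
  have hN : (numColors ε β : ℝ) ≠ 0 := NeZero.ne _
  refine (variance_colorEst_le G n hn le_rfl (NeZero.ne _) n.cast_nonneg).trans ?_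
  rw [div_self hN, sub_self, mul_zero, zero_mul, add_zero, sq, mul_div_cancel_right₀ _ hN]
  gcongr
  exact numColors_sub_one_le ε β

open Classical in
lemma cost_fullEst_le (hn : n ≤ 2 ^ h) (hε : 0 < ε) (hβ : 0 < β) :
    (fullEst n ε h β).cost G ≤
      β + (4 * h + 5) * (G.edgeFinset.card / β ^ 2 * (β + 20000 / ε ^ 2)) := by
  have hN : (numColors ε β : ℝ) ≠ 0 := NeZero.ne _
  have hNβ : (numColors ε β : ℝ) ≤ β := Nat.cast_le.mpr (max_le hβ (min_le_left _ _))
  have hinv := inv_numColors_le hε hβ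
  calc _ ≤ (numColors ε β : ℝ) +
        (4 * h + 5) * ((numColors ε β : ℝ)⁻¹ * G.edgeFinset.card) := by
        refine (cost_colorEst_le G n hn le_rfl).trans_eq ?_
        field_simp
    _ ≤ β + (4 * h + 5) * ((β + 20000 / ε ^ 2) / β ^ 2 * G.edgeFinset.card) := by gcongr
    _ = _ := by ring

/-- The number of color classes to be searched, and of neighbor samples, at level `b`. -/
noncomputable def numSamples (ε : ℝ) (b : ℕ) : ℕ := ⌈20000 * b / ε ^ 2⌉₊

lemma numSamples_ne_zero (hε : 0 < ε) (hb : 0 < b) : numSamples ε b ≠ 0 :=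
  (Nat.ceil_pos.mpr (by positivity)).ne'

lemma inv_numSamples_le (hε : 0 < ε) (hb : 0 < b) :
    (numSamples ε b : ℝ)⁻¹ ≤ ε ^ 2 / (20000 * b) := by
  rw [← inv_div]
  exact inv_anti₀ (by positivity) (Nat.le_ceil _)

lemma mul_le_numSamples (hε : 0 < ε) (hε1 : ε ≤ 1) : 20000 * (b : ℝ) ≤ numSamples ε b :=
  (le_div_self (by positivity) (by positivity) (pow_le_one₀ hε.le hε1)).trans (Nat.le_ceil _)

lemma numSamples_le (hε : 0 < ε) (hε1 : ε ≤ 1) (hb : 0 < b) :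
    (numSamples ε b : ℝ) ≤ 40000 * (b / ε ^ 2) := by
  have hb1 : (1 : ℝ) ≤ b := mod_cast hb
  have hlevel : 1 ≤ b / ε ^ 2 := by
    rw [one_le_div (by positivity)]
    exact (pow_le_one₀ hε.le hε1).trans hb1
  have hceil := (Nat.ceil_lt_add_one (show 0 ≤ 20000 * (b : ℝ) / ε ^ 2 by positivity)).le
  rw [mul_div_assoc] at hceil
  rw [numSamples, mul_div_assoc]
  linarith

variable (n) in
/-- The estimator for the number of edges whose endpoints both have degree less than `b * β / 2`,
for the guess `β ^ 2` for the number of edges. -/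
noncomputable def lightEst (ε : ℝ) (h b β : ℕ) [NeZero β] : QueryProg n ℝ :=
  colorEst n (b * β / 2) h β (numSamples ε b)

/-- The estimator for the number of edges with an endpoint of degree at least `b * β / 2`, for the
guess `β ^ 2` for the number of edges. -/
noncomputable def heavyEst [NeZero n] (ε : ℝ) (b β : ℕ) : QueryProg n ℝ :=
  (sample (b * β / 2) ⌈2 * (β : ℝ) / b⌉₊).average (numSamples ε b)

open Classical in
lemma variance_lightEst_le [NeZero β] (hn : n ≤ 2 ^ h) (hε : 0 < ε) (hb : 0 < b)
    (hβ : numSamples ε b ≤ β) :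
    (lightEst n ε h b β).variance G ≤ ε ^ 2 / 10000 * (G.edgeFinset.card * β ^ 2) := by
  have hb1 : (1 : ℝ) ≤ b := mod_cast hb
  have hs : (β : ℝ) ^ 2 * (numSamples ε b : ℝ)⁻¹ ≤ b * β ^ 2 * (numSamples ε b : ℝ)⁻¹ := by
    gcongr
    exact le_mul_of_one_le_left (by positivity) hb1
  have hfactor : (β : ℝ) ^ 2 / numSamples ε b - 1 + 2 * (β / numSamples ε b - 1) * (b * β / 2) ≤
      2 * (b * β ^ 2) * (numSamples ε b : ℝ)⁻¹ := by
    have : 0 ≤ (b : ℝ) * β := by positivity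
    linear_combination hs + this
  calc _ ≤ _ := variance_colorEst_le G _ hn hβ (numSamples_ne_zero hε hb) (by positivity)
    _ ≤ 2 * (b * β ^ 2) * (ε ^ 2 / (20000 * b)) * G.edgeFinset.card := by
        gcongr
        refine hfactor.trans ?_
        gcongr
        exact inv_numSamples_le hε hb
    _ = _ := by
        field_simp
        ring

open Classical in
lemma variance_heavyEst_le [NeZero n] (hε : 0 < ε) (hb : 0 < b) (hbβ : b ≤ β)
    (hnb : n ≤ β * b ^ 2) :
    (heavyEst ε b β).variance G ≤
      ε ^ 2 / 2500 * (G.edgeFinset.card * (G.edgeFinset.card + β ^ 2)) := by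
  have hβ : (0 : ℝ) < β := mod_cast hb.trans_le hbβ
  have hceil : (⌈2 * (β : ℝ) / b⌉₊ : ℝ) ≤ 3 * β / b := by
    have hone : 1 ≤ (β : ℝ) / b := (one_le_div (by positivity)).mpr (mod_cast hbβ)
    have := (Nat.ceil_lt_add_one (show 0 ≤ 2 * (β : ℝ) / b by positivity)).le
    linear_combination this + hone
  have hn : (n : ℝ) ≤ β * b ^ 2 := mod_cast hnb
  have hsample : (sample (n := n) (b * β / 2) ⌈2 * (β : ℝ) / b⌉₊).variance G ≤
      β * b ^ 2 * (2 * G.edgeFinset.card) * (3 * β / b + 2 * G.edgeFinset.card / (b * β / 2)) := by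
    refine ((variance_le_mean_sq G _).trans (mean_sq_sample_le G _ (by positivity)
      (Nat.ceil_pos.mpr (by positivity)))).trans ?_
    gcongr
  calc _ = (sample (n := n) (b * β / 2) ⌈2 * (β : ℝ) / b⌉₊).variance G *
        (numSamples ε b : ℝ)⁻¹ := by
        rw [heavyEst, variance_average, div_eq_mul_inv]
    _ ≤ β * b ^ 2 * (2 * G.edgeFinset.card) *
          (3 * β / b + 2 * G.edgeFinset.card / (b * β / 2)) * (ε ^ 2 / (20000 * b)) := by
        gcongr
        exact inv_numSamples_le hε hb
    _ = ε ^ 2 / 20000 * (G.edgeFinset.card * (8 * G.edgeFinset.card + 6 * β ^ 2)) := by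
        field_simp
        ring
    _ ≤ ε ^ 2 / 20000 * (G.edgeFinset.card * (8 * G.edgeFinset.card + 8 * β ^ 2)) := by
        gcongr
        norm_num
    _ = _ := by ring

open Classical in
lemma cost_lightEst_le [NeZero β] (hn : n ≤ 2 ^ h) (hβ : numSamples ε b ≤ β) :
    (lightEst n ε h b β).cost G ≤
      numSamples ε b * (1 + (4 * h + 5) * (G.edgeFinset.card / β ^ 2)) := by
  refine (cost_colorEst_le G _ hn hβ).trans_eq ?_
  ring

open Classical in
lemma cost_heavyEst_le [NeZero n] (hb : 0 < b) (hβ : 2 ≤ β) (hnb : (β - 1) * b ^ 2 ≤ n) :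
    (heavyEst ε b β).cost G ≤ numSamples ε b * (3 + 4 * (G.edgeFinset.card / β ^ 2)) := by
  have hb1 : (1 : ℝ) ≤ b := mod_cast hb
  have hβ2 : (2 : ℝ) ≤ β := mod_cast hβ
  have hn : (β : ℝ) / 2 * b ^ 2 ≤ n := by
    have hnb' : ((β - 1 : ℕ) : ℝ) * b ^ 2 ≤ n := mod_cast hnb
    rw [Nat.cast_sub (one_le_two.trans hβ), Nat.cast_one] at hnb'
    refine le_trans ?_ hnb'
    gcongr
    linarith
  have hden : (β : ℝ) ^ 2 ≤ n * ⌈2 * (β : ℝ) / b⌉₊ :=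
    calc (β : ℝ) ^ 2 ≤ b * β ^ 2 := le_mul_of_one_le_left (by positivity) hb1
      _ = β / 2 * b ^ 2 * (2 * β / b) := by field_simp
      _ ≤ n * ⌈2 * (β : ℝ) / b⌉₊ := by
        gcongr
        exact Nat.le_ceil _
  rw [heavyEst, cost_average]
  gcongr
  refine (cost_sample_le G _).trans ?_
  rw [← mul_div_assoc]
  gcongr

/-- The estimator for the guess `β ^ 2` for the number of edges that is used when `β` is large
compared with the level `b`. -/
noncomputable def highEst [NeZero n] (ε : ℝ) (h b β : ℕ) [NeZero β] : QueryProg n ℝ :=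
  if numSamples ε b ≤ β then (lightEst n ε h b β).add (heavyEst ε b β) else fullEst n ε h β

variable [NeZero n] [NeZero β]

open Classical in
lemma mean_id_highEst (hn : n ≤ 2 ^ h) (hε : 0 < ε) (hb : 0 < b) :
    (highEst ε h b β).mean G id = G.edgeFinset.card := by
  rw [highEst]
  split_ifs with hβ
  · have hs := numSamples_ne_zero hε hb
    rw [mean_id_add, lightEst, mean_id_colorEst G _ hn hβ hs, heavyEst, mean_id_average _ _ hs,
      mean_id_sample, add_sub_cancel]
  · exact mean_id_fullEst G hn

open Classical in
lemma variance_highEst_le (hn : n ≤ 2 ^ h) (hε : 0 < ε) (hε1 : ε ≤ 1) (hb : 0 < b)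
    (hnb : n ≤ β * b ^ 2) :
    (highEst ε h b β).variance G ≤
      ε ^ 2 / 1000 * (G.edgeFinset.card * (G.edgeFinset.card + β ^ 2)) := by
  have hsq : 0 ≤ ε ^ 2 * ((G.edgeFinset.card : ℝ) * G.edgeFinset.card) := by positivity
  have hmul : 0 ≤ ε ^ 2 * ((G.edgeFinset.card : ℝ) * β ^ 2) := by positivity
  rw [highEst]
  split_ifs with hβ
  · have hbβ : b ≤ β := by
      have hb' : 20000 * b ≤ numSamples ε b := mod_cast mul_le_numSamples (b := b) hε hε1
      omega
    have hlight := variance_lightEst_le G hn hε hb hβ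
    have hheavy := variance_heavyEst_le G hε hb hbβ hnb
    rw [variance_add]
    linarith
  · have := variance_fullEst_le (ε := ε) (β := β) G hn
    linarith

open Classical in
lemma cost_highEst_le (hn : n ≤ 2 ^ h) (hε : 0 < ε) (hε1 : ε ≤ 1) (hb : 0 < b)
    (hnb : (β - 1) * b ^ 2 ≤ n) :
    (highEst ε h b β).cost G ≤
      80000 * (4 * h + 5) * (b / ε ^ 2) * (1 + G.edgeFinset.card / β ^ 2) := by
  have hs := numSamples_le hε hε1 hb
  have hx : 0 ≤ (G.edgeFinset.card : ℝ) / β ^ 2 := by positivity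
  have hhx := mul_nonneg (Nat.cast_nonneg (α := ℝ) h) hx
  rw [highEst]
  split_ifs with hβ
  · have hβ2 : 2 ≤ β := by
      have hb' : 20000 * b ≤ numSamples ε b := mod_cast mul_le_numSamples (b := b) hε hε1
      omega
    rw [cost_add]
    calc _ ≤ (numSamples ε b : ℝ) * (1 + (4 * h + 5) * (G.edgeFinset.card / β ^ 2)) +
          numSamples ε b * (3 + 4 * (G.edgeFinset.card / β ^ 2)) :=
          add_le_add (cost_lightEst_le G hn hβ) (cost_heavyEst_le G hb hβ2 hnb)
      _ = (numSamples ε b : ℝ) * (4 + (4 * h + 9) * (G.edgeFinset.card / β ^ 2)) := by ring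
      _ ≤ 40000 * (b / ε ^ 2) * (2 * (4 * h + 5) * (1 + G.edgeFinset.card / β ^ 2)) := by
          gcongr
          linarith
      _ = _ := by ring
  · have hβs : (β : ℝ) ≤ 40000 * (b / ε ^ 2) :=
      le_trans (mod_cast (not_le.mp hβ).le) hs
    have hεb : 20000 / ε ^ 2 ≤ 20000 * (b / ε ^ 2) := by
      rw [mul_div_assoc']
      gcongr
      exact le_mul_of_one_le_right (by norm_num) (mod_cast hb)
    calc _ ≤ β + (4 * h + 5) * (G.edgeFinset.card / β ^ 2 * (β + 20000 / ε ^ 2)) :=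
          cost_fullEst_le G hn hε (NeZero.pos β)
      _ ≤ 40000 * (b / ε ^ 2) + (4 * h + 5) *
          (G.edgeFinset.card / β ^ 2 * (40000 * (b / ε ^ 2) + 20000 * (b / ε ^ 2))) := by gcongr
      _ = 20000 * (b / ε ^ 2) * (2 + (4 * h + 5) * (3 * (G.edgeFinset.card / β ^ 2))) := by ring
      _ ≤ 20000 * (b / ε ^ 2) * (4 * (4 * h + 5) * (1 + G.edgeFinset.card / β ^ 2)) := by
          gcongr
          linarith
      _ = _ := by ring

end QueryProg

/-- The guess for the square root of the number of edges at level `i` of the search from above: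
about `n / 4 ^ i`, rounded up so that it stays positive. -/
def topGuess (n i : ℕ) : ℕ := (n - 1) / 4 ^ i + 1

section TopGuess

variable {n : ℕ} {i j : ℕ}

instance (n i : ℕ) : NeZero (topGuess n i) := ⟨Nat.succ_ne_zero _⟩

lemma topGuess_le_four_mul (n i : ℕ) : topGuess n i ≤ 4 * topGuess n (i + 1) := by
  rw [topGuess, topGuess, pow_succ, ← Nat.div_div_eq_div_mul]
  omega

lemma two_mul_topGuess_le (h : 2 ≤ topGuess n (i + 1)) :
    2 * topGuess n (i + 1) ≤ topGuess n i := by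
  rw [topGuess, pow_succ, ← Nat.div_div_eq_div_mul] at h ⊢
  rw [topGuess]
  omega

lemma topGuess_anti (n : ℕ) : Antitone (topGuess n) := fun _ _ hij =>
  Nat.add_le_add_right
    (Nat.div_le_div_left (Nat.pow_le_pow_right four_pos hij) (pow_pos four_pos _)) 1

lemma le_topGuess_zero (n : ℕ) : n ≤ topGuess n 0 := by
  rw [topGuess, pow_zero, Nat.div_one]
  omega

lemma le_topGuess_mul (n i : ℕ) : n ≤ topGuess n i * (2 ^ i) ^ 2 := by
  rw [pow_right_comm, topGuess, Nat.add_one_mul]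
  have := Nat.lt_div_mul_add (a := n - 1) (b := 4 ^ i) (pow_pos four_pos i)
  norm_num
  omega

lemma topGuess_sub_one_mul_le (n i : ℕ) : (topGuess n i - 1) * (2 ^ i) ^ 2 ≤ n := by
  rw [pow_right_comm, topGuess, Nat.add_sub_cancel]
  exact (Nat.div_mul_le_self _ _).trans (Nat.sub_le _ _)

lemma topGuess_mul_le (h : 2 ≤ topGuess n i) : topGuess n i * 4 ^ i ≤ 2 * n :=
  calc topGuess n i * 4 ^ i ≤ 2 * (topGuess n i - 1) * 4 ^ i := by
        gcongr
        omega
    _ = 2 * ((topGuess n i - 1) * (2 ^ i) ^ 2) := by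
        rw [pow_right_comm, mul_assoc]
        norm_num
    _ ≤ 2 * n := Nat.mul_le_mul_left _ (topGuess_sub_one_mul_le n i)

end TopGuess

/-- `IsCrossing n m l` says that `l` is the first level at which the increasing guesses `4 ^ i` or
the decreasing guesses `topGuess n i ^ 2` pass the number `m`. -/
structure IsCrossing (n : ℕ) (m : ℝ) (l : ℕ) : Prop where
  bounds_of_lt : ∀ j < l, 4 ^ j < m ∧ m < (topGuess n j : ℝ) ^ 2
  le_or_le_self : m ≤ 4 ^ l ∨ (topGuess n l : ℝ) ^ 2 ≤ m

lemma exists_isCrossing {n : ℕ} {m : ℝ} (hmn : m ≤ n ^ 2) : ∃ l ≤ n, IsCrossing n m l := by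
  classical
  have hn : m ≤ 4 ^ n := by
    have hpow : (n : ℝ) ≤ 2 ^ n := mod_cast Nat.lt_two_pow_self.le
    calc m ≤ n ^ 2 := hmn
      _ ≤ (2 ^ n) ^ 2 := by gcongr
      _ = 4 ^ n := by
        rw [pow_right_comm]
        norm_num
  have hex : ∃ i, m ≤ 4 ^ i ∨ (topGuess n i : ℝ) ^ 2 ≤ m := ⟨n, .inl hn⟩
  exact ⟨Nat.find hex, Nat.find_min' hex (.inl hn),
    fun j hj => by simpa only [not_or, not_le] using Nat.find_min hex hj, Nat.find_spec hex⟩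

namespace IsCrossing

variable {n : ℕ} {m : ℝ} {l : ℕ}

lemma le_or_le (h : IsCrossing n m l) {i : ℕ} (hi : l ≤ i) :
    m ≤ 4 ^ i ∨ (topGuess n i : ℝ) ^ 2 ≤ m := by
  have hlow : (4 : ℝ) ^ l ≤ 4 ^ i := pow_le_pow_right₀ (by norm_num) hi
  have hhigh : (topGuess n i : ℝ) ^ 2 ≤ (topGuess n l : ℝ) ^ 2 := by
    gcongr
    exact topGuess_anti n hi
  exact h.le_or_le_self.imp (le_trans · hlow) (le_trans hhigh ·)

lemma two_le_topGuess (h : IsCrossing n m l) {j : ℕ} (hj : j < l) : 2 ≤ topGuess n j := by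
  obtain ⟨hlow, hhigh⟩ := h.bounds_of_lt j hj
  have hone : (1 : ℝ) ^ 2 < (topGuess n j : ℝ) ^ 2 := by
    rw [one_pow]
    exact (one_le_pow₀ (by norm_num)).trans_lt (hlow.trans hhigh)
  exact_mod_cast lt_of_pow_lt_pow_left₀ 2 (Nat.cast_nonneg _) hone

lemma four_pow_le (h : IsCrossing n m l) (hm : 1 ≤ m) : (4 : ℝ) ^ l ≤ 4 * m := by
  cases l with
  | zero => linarith [pow_zero (4 : ℝ)]
  | succ k =>
    rw [pow_succ']
    gcongr
    exact (h.bounds_of_lt k k.lt_succ_self).1.le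

lemma four_pow_mul_sqrt_le (h : IsCrossing n m l) (hmn : m ≤ n ^ 2) :
    (4 : ℝ) ^ l * √m ≤ 8 * n := by
  cases l with
  | zero =>
    have hsqrt : √m ≤ n := Real.sqrt_le_left n.cast_nonneg |>.mpr hmn
    rw [pow_zero, one_mul]
    linarith [n.cast_nonneg (α := ℝ)]
  | succ k =>
    have hsqrt : √m ≤ topGuess n k :=
      Real.sqrt_le_left (Nat.cast_nonneg _) |>.mpr (h.bounds_of_lt k k.lt_succ_self).2.le
    have hmul : (topGuess n k : ℝ) * 4 ^ k ≤ 2 * n :=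
      mod_cast topGuess_mul_le (h.two_le_topGuess k.lt_succ_self)
    calc (4 : ℝ) ^ (k + 1) * √m ≤ 4 ^ (k + 1) * topGuess n k := by gcongr
      _ = 4 * (topGuess n k * 4 ^ k) := by ring
      _ ≤ 4 * (2 * n) := by gcongr
      _ = 8 * n := by ring

lemma mul_four_pow_le_sq (h : IsCrossing n m l) {j d : ℕ} (hj : j + d < l) :
    m * 4 ^ d ≤ (topGuess n j : ℝ) ^ 2 := by
  induction d generalizing j with
  | zero =>
    rw [pow_zero, mul_one]
    exact (h.bounds_of_lt j hj).2.le
  | succ d ih =>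
    have htwo : 2 * (topGuess n (j + 1) : ℝ) ≤ topGuess n j :=
      mod_cast two_mul_topGuess_le (h.two_le_topGuess (by omega))
    calc m * 4 ^ (d + 1) = 4 * (m * 4 ^ d) := by ring
      _ ≤ 4 * (topGuess n (j + 1) : ℝ) ^ 2 := by
        gcongr
        exact ih (by omega)
      _ = (2 * topGuess n (j + 1)) ^ 2 := by ring
      _ ≤ (topGuess n j : ℝ) ^ 2 := by gcongr

lemma mul_four_pow_le (h : IsCrossing n m l) {j : ℕ} (hj : j < l) :
    m * 4 ^ l ≤ 4 * 4 ^ j * (topGuess n j : ℝ) ^ 2 := by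
  obtain ⟨d, rfl⟩ := Nat.exists_eq_add_of_lt hj
  calc m * 4 ^ (j + d + 1) = 4 * 4 ^ j * (m * 4 ^ d) := by ring
    _ ≤ _ := by
      gcongr
      exact h.mul_four_pow_le_sq (Nat.lt_succ_self _)

lemma le_sixteen_pow_mul (h : IsCrossing n m l) (hmn : m ≤ n ^ 2) (j : ℕ) :
    m ≤ 16 ^ (j + 1) * (topGuess n (l + j) : ℝ) ^ 2 := by
  have hstep (i : ℕ) : (topGuess n i : ℝ) ^ 2 ≤ 16 * (topGuess n (i + 1) : ℝ) ^ 2 :=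
    calc (topGuess n i : ℝ) ^ 2 ≤ (4 * topGuess n (i + 1)) ^ 2 := by
          gcongr
          exact_mod_cast topGuess_le_four_mul n i
      _ = _ := by ring
  induction j with
  | zero =>
    cases l with
    | zero =>
      have hzero : (n : ℝ) ≤ topGuess n 0 := mod_cast le_topGuess_zero n
      calc m ≤ (n : ℝ) ^ 2 := hmn
        _ ≤ (topGuess n 0 : ℝ) ^ 2 := by gcongr
        _ ≤ 16 ^ (0 + 1) * (topGuess n (0 + 0) : ℝ) ^ 2 :=
          le_mul_of_one_le_left (by positivity) (by norm_num)
    | succ k => simpa using (h.bounds_of_lt k k.lt_succ_self).2.le.trans (hstep k)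
  | succ j ih =>
    calc m ≤ 16 ^ (j + 1) * (topGuess n (l + j) : ℝ) ^ 2 := ih
      _ ≤ 16 ^ (j + 1) * (16 * (topGuess n (l + j + 1) : ℝ) ^ 2) := by
        gcongr
        exact hstep _
      _ = _ := by ring_nf

end IsCrossing

namespace QueryProg

section OrElse

variable {n : ℕ} {α β : Type} (G : SimpleGraph (Fin n))

lemma prob_map (f : α → β) (p : QueryProg n α) (S : Set β) :
    (p.map f).prob G S = p.prob G (f ⁻¹' S) :=
  mean_map G f p _

lemma prob_union_le (p : QueryProg n α) (S T : Set α) :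
    p.prob G (S ∪ T) ≤ p.prob G S + p.prob G T := by
  rw [prob, prob, prob, ← mean_add]
  refine mean_mono G p fun a => ?_
  have hinter : 0 ≤ (S ∩ T).indicator (1 : α → ℝ) a :=
    Set.indicator_nonneg (fun _ _ => zero_le_one) a
  have hunion := congrFun (Set.indicator_union_add_inter (1 : α → ℝ) S T) a
  simp only [Pi.add_apply] at hunion
  linarith

/-- Run `p`, and if its output is `none`, run `q`. -/
def orElse (p : QueryProg n (Option α)) (q : QueryProg n α) : QueryProg n α :=
  p.bind fun o => o.elim q ret

variable (p : QueryProg n (Option α)) (q : QueryProg n α)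

lemma cost_orElse : (p.orElse q).cost G = p.cost G + p.prob G {none} * q.cost G := by
  rw [orElse, cost_bind, prob, mul_comm _ (q.cost G), ← mean_const_mul]
  congr 2
  ext o
  cases o <;> simp [cost]

lemma prob_orElse (S : Set α) :
    (p.orElse q).prob G S = p.prob G (some '' S) + p.prob G {none} * q.prob G S := by
  rw [orElse, prob, mean_bind, prob, prob, mul_comm _ (q.prob G S), ← mean_const_mul, ← mean_add]
  congr 1
  ext o
  cases o with
  | none => simp [prob]
  | some a =>
    simp only [Option.elim_some, mean, Set.indicator_image (Option.some_injective α)]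
    simp

lemma cost_orElse_orElse_le (p q : QueryProg n (Option α)) (r : QueryProg n α) :
    (p.orElse (q.orElse r)).cost G ≤
      p.cost G + q.cost G + p.prob G {none} * q.prob G {none} * r.cost G := by
  have := mul_le_of_le_one_left (cost_nonneg G q) (prob_le_one G p {none})
  rw [cost_orElse, cost_orElse]
  linarith

lemma prob_orElse_orElse_le (p q : QueryProg n (Option α)) (r : QueryProg n α) (S : Set α) :
    (p.orElse (q.orElse r)).prob G S ≤
      p.prob G (some '' S) + q.prob G (some '' S) +
        p.prob G {none} * q.prob G {none} * r.prob G S := by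
  have := mul_le_of_le_one_left (prob_nonneg G q (some '' S)) (prob_le_one G p {none})
  rw [prob_orElse, prob_orElse]
  linarith

end OrElse

/-- The outputs that differ from `m` by more than the factor `1 ± ε`. -/
def inaccurate (ε m : ℝ) : Set ℝ := {x | ε * m < |x - m|}

variable {n : ℕ} (G : SimpleGraph (Fin n)) {ε : ℝ} {h b β : ℕ}

section Below

/-- The largest number of queries the search from below may spend at the guess `β ^ 2`: `128` times
the bound on the expected number when the guess is at least the number of edges. -/
noncomputable def budget (ε : ℝ) (h β : ℕ) : ℕ := ⌈5120000 * ((4 * h + 5) * (β / ε ^ 2))⌉₊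

variable (n) in
/-- One step of the search from below: the estimator `fullEst` within its budget, whose output is
accepted only if it is not too large for the guess `β ^ 2`. -/
noncomputable def belowEst (ε : ℝ) (h β : ℕ) : QueryProg n (Option ℝ) :=
  ((fullEst n ε h β).trunc (budget ε h β)).map (Option.filter (· ≤ 2 * β ^ 2))

lemma cost_belowEst_le : (belowEst n ε h β).cost G ≤ 5120000 * ((4 * h + 5) * (β / ε ^ 2)) + 1 := by
  rw [belowEst, cost_map]
  exact (cost_trunc_le G _ _).trans (Nat.ceil_lt_add_one (by positivity)).le

open Classical in
lemma prob_belowEst_some_le (hn : n ≤ 2 ^ h) (hε : 0 < ε) (hm : 0 < G.edgeFinset.card) :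
    (belowEst n ε h β).prob G (some '' inaccurate ε G.edgeFinset.card) ≤
      β ^ 2 / (20000 * G.edgeFinset.card) := by
  have hsub : Option.filter (fun x : ℝ => x ≤ 2 * β ^ 2) ⁻¹'
      (some '' inaccurate ε G.edgeFinset.card) ⊆ some '' inaccurate ε G.edgeFinset.card := by
    rintro o ⟨x, hx, hxo⟩
    exact ⟨x, hx, (Option.filter_eq_some_iff.mp hxo.symm).1.symm⟩
  rw [belowEst, prob_map]
  refine ((prob_mono G _ hsub).trans (prob_trunc_some_le G _ _ _)).trans ?_
  have hcheb := sq_mul_prob_le_variance G (fullEst n ε h β) (t := ε * G.edgeFinset.card)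
    (S := inaccurate ε G.edgeFinset.card) (by positivity) fun x hx => by
      rw [mean_id_fullEst G hn]
      exact hx.le
  refine le_of_mul_le_mul_left (hcheb.trans ((variance_fullEst_le G hn).trans_eq ?_))
    (show 0 < (ε * G.edgeFinset.card) ^ 2 by positivity)
  field_simp

open Classical in
lemma prob_fullEst_Ioi_le (hn : n ≤ 2 ^ h) (hε : 0 ≤ ε) (hε1 : ε ≤ 1) (hβ : 0 < β)
    (hm : G.edgeFinset.card ≤ β ^ 2) :
    (fullEst n ε h β).prob G (Set.Ioi (2 * β ^ 2)) ≤ 1 / 20000 := by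
  have hm' : (G.edgeFinset.card : ℝ) ≤ β ^ 2 := mod_cast hm
  have hcheb := sq_mul_prob_le_variance G (fullEst n ε h β) (t := β ^ 2)
    (S := Set.Ioi (2 * β ^ 2)) (by positivity) fun x hx => by
      rw [mean_id_fullEst G hn]
      linarith [le_abs_self (x - G.edgeFinset.card), Set.mem_Ioi.mp hx]
  refine le_of_mul_le_mul_left (hcheb.trans ((variance_fullEst_le G hn).trans ?_))
    (show (0 : ℝ) < (β ^ 2) ^ 2 by positivity)
  calc ε ^ 2 * β ^ 2 / 20000 * G.edgeFinset.card ≤ 1 * β ^ 2 / 20000 * β ^ 2 := by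
        gcongr
        exact pow_le_one₀ hε hε1
    _ = _ := by ring

open Classical in
lemma cost_fullEst_le_of_le (hn : n ≤ 2 ^ h) (hε : 0 < ε) (hε1 : ε ≤ 1) (hβ : 0 < β)
    (hm : G.edgeFinset.card ≤ β ^ 2) :
    (fullEst n ε h β).cost G ≤ 40000 * ((4 * h + 5) * (β / ε ^ 2)) := by
  have hβ1 : (1 : ℝ) ≤ β := mod_cast hβ
  have hratio : (G.edgeFinset.card : ℝ) / β ^ 2 ≤ 1 :=
    div_le_one_of_le₀ (mod_cast hm) (by positivity)
  have hβε : (β : ℝ) ≤ β / ε ^ 2 :=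
    le_div_self (by positivity) (by positivity) (pow_le_one₀ hε.le hε1)
  have hεβ : 20000 / ε ^ 2 ≤ 20000 * (β / ε ^ 2) := by
    rw [mul_div_assoc']
    gcongr
    exact le_mul_of_one_le_right (by norm_num) hβ1
  have hpos : 0 ≤ β / ε ^ 2 * h := by positivity
  calc _ ≤ β + (4 * h + 5) * (G.edgeFinset.card / β ^ 2 * (β + 20000 / ε ^ 2)) :=
        cost_fullEst_le G hn hε hβ
    _ ≤ β / ε ^ 2 + (4 * h + 5) * (1 * (β / ε ^ 2 + 20000 * (β / ε ^ 2))) := by gcongr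
    _ ≤ _ := by linarith

open Classical in
lemma prob_trunc_fullEst_none_le (hn : n ≤ 2 ^ h) (hε : 0 < ε) (hε1 : ε ≤ 1) (hβ : 0 < β)
    (hm : G.edgeFinset.card ≤ β ^ 2) :
    ((fullEst n ε h β).trunc (budget ε h β)).prob G {none} ≤ 1 / 128 := by
  have hbudget : 5120000 * ((4 * h + 5) * (β / ε ^ 2)) ≤ (budget ε h β : ℝ) + 1 :=
    (Nat.le_ceil _).trans (le_add_of_nonneg_right zero_le_one)
  refine le_of_mul_le_mul_left ?_
    (show 0 < 5120000 * (((4 : ℝ) * h + 5) * (β / ε ^ 2)) by positivity)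
  calc _ ≤ ((budget ε h β : ℝ) + 1) * ((fullEst n ε h β).trunc (budget ε h β)).prob G {none} := by
        gcongr
        exact prob_nonneg G _ _
    _ ≤ (fullEst n ε h β).cost G := succ_mul_prob_trunc_none_le G _ _
    _ ≤ 40000 * ((4 * h + 5) * (β / ε ^ 2)) := cost_fullEst_le_of_le G hn hε hε1 hβ hm
    _ = _ := by ring

open Classical in
lemma prob_belowEst_none_le (hn : n ≤ 2 ^ h) (hε : 0 < ε) (hε1 : ε ≤ 1) (hβ : 0 < β)
    (hm : G.edgeFinset.card ≤ β ^ 2) : (belowEst n ε h β).prob G {none} ≤ 1 / 64 := by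
  have hsub : Option.filter (fun x : ℝ => x ≤ 2 * β ^ 2) ⁻¹' {none} ⊆
      {none} ∪ some '' Set.Ioi (2 * (β : ℝ) ^ 2) := by
    rintro (_ | x) hx
    · exact .inl rfl
    · exact .inr ⟨x, by simpa [Option.filter] using hx, rfl⟩
  rw [belowEst, prob_map]
  have hnone := prob_trunc_fullEst_none_le G hn hε hε1 hβ hm
  have hsome := (prob_trunc_some_le G (budget ε h β) _ _).trans
    (prob_fullEst_Ioi_le G hn hε.le hε1 hβ hm)
  linarith [(prob_mono G _ hsub).trans (prob_union_le G
    ((fullEst n ε h β).trunc (budget ε h β)) _ _)]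

end Below

section Above

variable [NeZero n] [NeZero β]

/-- One step of the search from above: the estimator `highEst`, whose output is accepted only if it
is not too small for the guess `β ^ 2`. -/
noncomputable def aboveEst (ε : ℝ) (h b β : ℕ) [NeZero β] : QueryProg n (Option ℝ) :=
  (highEst ε h b β).map (Option.guard ((β : ℝ) ^ 2 / 2 ≤ ·))

lemma prob_aboveEst_some (S : Set ℝ) :
    (aboveEst ε h b β).prob G (some '' S) =
      (highEst ε h b β).prob G (S ∩ Set.Ici ((β : ℝ) ^ 2 / 2)) := by
  rw [aboveEst, prob_map]
  congr 1
  ext x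
  constructor
  · rintro ⟨y, hy, hyx⟩
    obtain ⟨rfl, hx⟩ := Option.guard_eq_some_iff.mp hyx.symm
    exact ⟨hy, of_decide_eq_true hx⟩
  · rintro ⟨hS, hx⟩
    exact ⟨x, hS, (Option.guard_eq_some_iff.mpr ⟨rfl, by simpa using hx⟩).symm⟩

lemma prob_aboveEst_none :
    (aboveEst ε h b β).prob G {none} =
      (highEst ε h b β).prob G (Set.Iio ((β : ℝ) ^ 2 / 2)) := by
  rw [aboveEst, prob_map]
  congr 1
  ext x
  simp

open Classical in
lemma prob_aboveEst_some_le_of_le (hn : n ≤ 2 ^ h) (hε : 0 < ε) (hε1 : ε ≤ 1) (hb : 0 < b)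
    (hnb : n ≤ β * b ^ 2) (hm : 0 < G.edgeFinset.card)
    (hβm : (β : ℝ) ^ 2 ≤ 4 * G.edgeFinset.card) :
    (aboveEst ε h b β).prob G (some '' inaccurate ε G.edgeFinset.card) ≤ 1 / 200 := by
  rw [prob_aboveEst_some]
  have hcheb := sq_mul_prob_le_variance G (highEst ε h b β) (t := ε * G.edgeFinset.card)
    (S := inaccurate ε G.edgeFinset.card ∩ Set.Ici ((β : ℝ) ^ 2 / 2)) (by positivity)
    fun x hx => by
      rw [mean_id_highEst G hn hε hb]
      exact hx.1.le
  refine le_of_mul_le_mul_left (hcheb.trans ((variance_highEst_le G hn hε hε1 hb hnb).trans ?_))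
    (show 0 < (ε * G.edgeFinset.card) ^ 2 by positivity)
  calc _ ≤ ε ^ 2 / 1000 *
        (G.edgeFinset.card * (G.edgeFinset.card + 4 * (G.edgeFinset.card : ℝ))) := by gcongr
    _ = _ := by ring

open Classical in
lemma prob_aboveEst_some_le_of_ge (hn : n ≤ 2 ^ h) (hε : 0 < ε) (hε1 : ε ≤ 1) (hb : 0 < b)
    (hnb : n ≤ β * b ^ 2) (hβm : 4 * G.edgeFinset.card ≤ (β : ℝ) ^ 2) (S : Set ℝ) :
    (aboveEst ε h b β).prob G (some '' S) ≤ 4 / 125 * (G.edgeFinset.card / β ^ 2) := by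
  have hβ : (0 : ℝ) < β := mod_cast NeZero.pos β
  rw [prob_aboveEst_some]
  have hcheb := sq_mul_prob_le_variance G (highEst ε h b β) (t := (β : ℝ) ^ 2 / 4)
    (S := S ∩ Set.Ici ((β : ℝ) ^ 2 / 2)) (by positivity) fun x hx => by
      rw [mean_id_highEst G hn hε hb]
      linarith [le_abs_self (x - G.edgeFinset.card), Set.mem_Ici.mp hx.2]
  refine le_of_mul_le_mul_left (hcheb.trans ((variance_highEst_le G hn hε hε1 hb hnb).trans ?_))
    (show 0 < ((β : ℝ) ^ 2 / 4) ^ 2 by positivity)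
  calc _ ≤ 1 / 1000 * (G.edgeFinset.card * ((β : ℝ) ^ 2 + β ^ 2)) := by
        gcongr
        · exact pow_le_one₀ hε.le hε1
        · exact (le_mul_of_one_le_left (Nat.cast_nonneg _) (by norm_num)).trans hβm
    _ = _ := by
        field_simp
        ring

open Classical in
lemma prob_aboveEst_some_le (hn : n ≤ 2 ^ h) (hε : 0 < ε) (hε1 : ε ≤ 1) (hb : 0 < b)
    (hnb : n ≤ β * b ^ 2) (hm : 0 < G.edgeFinset.card) :
    (aboveEst ε h b β).prob G (some '' inaccurate ε G.edgeFinset.card) ≤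
      4 / 125 * min (1 / 4) (G.edgeFinset.card / (β : ℝ) ^ 2) := by
  have hβ : (0 : ℝ) < β := mod_cast NeZero.pos β
  rcases le_total ((β : ℝ) ^ 2) (4 * G.edgeFinset.card) with hβm | hβm
  · have hratio : 1 / 4 ≤ G.edgeFinset.card / (β : ℝ) ^ 2 := by
      rw [div_le_div_iff₀ (by norm_num) (by positivity)]
      linarith
    rw [min_eq_left hratio]
    exact (prob_aboveEst_some_le_of_le G hn hε hε1 hb hnb hm hβm).trans (by norm_num)
  · have hratio : G.edgeFinset.card / (β : ℝ) ^ 2 ≤ 1 / 4 := by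
      rw [div_le_div_iff₀ (by positivity) (by norm_num)]
      linarith
    rw [min_eq_right hratio]
    exact prob_aboveEst_some_le_of_ge G hn hε hε1 hb hnb hβm _

open Classical in
lemma prob_aboveEst_none_le (hn : n ≤ 2 ^ h) (hε : 0 < ε) (hε1 : ε ≤ 1) (hb : 0 < b)
    (hnb : n ≤ β * b ^ 2) (hβm : (β : ℝ) ^ 2 ≤ G.edgeFinset.card) :
    (aboveEst ε h b β).prob G {none} ≤ 1 / 64 := by
  have hβ : (0 : ℝ) < β := mod_cast NeZero.pos β
  have hm : (0 : ℝ) < G.edgeFinset.card := lt_of_lt_of_le (by positivity) hβm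
  rw [prob_aboveEst_none]
  have hcheb := sq_mul_prob_le_variance G (highEst ε h b β) (t := (G.edgeFinset.card : ℝ) / 2)
    (S := Set.Iio ((β : ℝ) ^ 2 / 2)) (by positivity) fun x hx => by
      rw [mean_id_highEst G hn hε hb]
      linarith [neg_le_abs (x - G.edgeFinset.card), Set.mem_Iio.mp hx]
  refine le_of_mul_le_mul_left (hcheb.trans ((variance_highEst_le G hn hε hε1 hb hnb).trans ?_))
    (show 0 < ((G.edgeFinset.card : ℝ) / 2) ^ 2 by positivity)
  calc _ ≤ 1 / 512 * (G.edgeFinset.card * ((G.edgeFinset.card : ℝ) + G.edgeFinset.card)) := by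
        gcongr
        · exact pow_le_one₀ hε.le hε1
        · norm_num
    _ = _ := by ring

/-- An upper bound for the number of queries per unit of the guess at one level of the search. -/
noncomputable def levelCost (ε : ℝ) (h : ℕ) : ℝ := 6000000 * (4 * h + 5) / ε ^ 2

lemma levelCost_nonneg (ε : ℝ) (h : ℕ) : 0 ≤ levelCost ε h := by
  unfold levelCost
  positivity

open Classical in
lemma cost_belowEst_add_cost_aboveEst_le (hn : n ≤ 2 ^ h) (hε : 0 < ε) (hε1 : ε ≤ 1) (hb : 0 < b)
    (hnb : (β - 1) * b ^ 2 ≤ n) :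
    (belowEst n ε h b).cost G + (aboveEst ε h b β).cost G ≤
      levelCost ε h * b * (1 + G.edgeFinset.card / β ^ 2) := by
  have hb1 : (1 : ℝ) ≤ b := mod_cast hb
  have hone : 1 ≤ (4 * (h : ℝ) + 5) * (b / ε ^ 2) := by
    have hbε : 1 ≤ b / ε ^ 2 :=
      hb1.trans (le_div_self (by positivity) (by positivity) (pow_le_one₀ hε.le hε1))
    exact one_le_mul_of_one_le_of_one_le (by linarith [h.cast_nonneg (α := ℝ)]) hbε
  have hlevel : levelCost ε h * b * (1 + G.edgeFinset.card / β ^ 2) =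
      6000000 * ((4 * h + 5) * (b / ε ^ 2) * (1 + G.edgeFinset.card / β ^ 2)) := by
    rw [levelCost]
    ring
  have hratio : (4 * (h : ℝ) + 5) * (b / ε ^ 2) ≤
      (4 * h + 5) * (b / ε ^ 2) * (1 + G.edgeFinset.card / β ^ 2) :=
    le_mul_of_one_le_right (by positivity) (le_add_of_nonneg_right (by positivity))
  have habove := cost_highEst_le G hn hε hε1 hb hnb
  rw [aboveEst, cost_map, hlevel]
  linarith [cost_belowEst_le G (ε := ε) (h := h) (β := b)]

end Above

end QueryProg

open Classical in
lemma card_edgeFinset_le_sq {n : ℕ} (G : SimpleGraph (Fin n)) :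
    (G.edgeFinset.card : ℝ) ≤ n ^ 2 := by
  have hchoose := G.card_edgeFinset_le_card_choose_two
  rw [Fintype.card_fin] at hchoose
  exact_mod_cast hchoose.trans (Nat.choose_le_pow n 2)

lemma cast_two_pow_sq (i : ℕ) : ((2 ^ i : ℕ) : ℝ) ^ 2 = 4 ^ i := by
  rw [Nat.cast_pow, Nat.cast_ofNat, pow_right_comm]
  norm_num

namespace QueryProg

variable {n : ℕ} (G : SimpleGraph (Fin n)) {ε : ℝ} {h l i : ℕ}

open Classical in
lemma prob_belowEst_some_le_of_isCrossing (hn : n ≤ 2 ^ h) (hε : 0 < ε)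
    (hm : 0 < G.edgeFinset.card) (hc : IsCrossing n G.edgeFinset.card l) :
    (belowEst n ε h (2 ^ i)).prob G (some '' inaccurate ε G.edgeFinset.card) ≤
      1 / 5000 * (4 ^ i / 4 ^ l) := by
  have hl := hc.four_pow_le (mod_cast hm)
  refine (prob_belowEst_some_le G hn hε hm).trans ?_
  rw [cast_two_pow_sq, div_mul_div_comm, one_mul]
  exact div_le_div_of_nonneg_left (by positivity) (by positivity) (by linarith)

variable [NeZero n]

/-- Search for the number of edges from below and from above at the same time: `search ε h k i`
tries the `k` levels from level `i` on. -/
noncomputable def search (ε : ℝ) (h : ℕ) : ℕ → ℕ → QueryProg n ℝ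
  | 0, _ => ret 0
  | k + 1, i => (belowEst n ε h (2 ^ i)).orElse
      ((aboveEst ε h (2 ^ i) (topGuess n i)).orElse (search ε h k (i + 1)))

open Classical in
lemma prob_none_mul_prob_none_le (hn : n ≤ 2 ^ h) (hε : 0 < ε) (hε1 : ε ≤ 1)
    (hc : IsCrossing n G.edgeFinset.card l) (hi : l ≤ i) :
    (belowEst n ε h (2 ^ i)).prob G {none} *
      (aboveEst ε h (2 ^ i) (topGuess n i)).prob G {none} ≤ 1 / 64 := by
  rcases hc.le_or_le hi with hm | hm
  · rw [← cast_two_pow_sq] at hm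
    exact (mul_le_of_le_one_right (prob_nonneg G _ _) (prob_le_one G _ _)).trans
      (prob_belowEst_none_le G hn hε hε1 (by positivity) (mod_cast hm))
  · exact (mul_le_of_le_one_left (prob_nonneg G _ _) (prob_le_one G _ _)).trans
      (prob_aboveEst_none_le G hn hε hε1 (by positivity) (le_topGuess_mul n i) hm)

section Error

open Classical in
lemma prob_aboveEst_some_le_of_isCrossing (hn : n ≤ 2 ^ h) (hε : 0 < ε) (hε1 : ε ≤ 1)
    (hm : 0 < G.edgeFinset.card) (hc : IsCrossing n G.edgeFinset.card l) (hi : i ≤ l) :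
    (aboveEst ε h (2 ^ i) (topGuess n i)).prob G (some '' inaccurate ε G.edgeFinset.card) ≤
      16 / 125 * (4 ^ i / 4 ^ l) := by
  refine (prob_aboveEst_some_le G hn hε hε1 (by positivity) (le_topGuess_mul n i) hm).trans ?_
  rcases hi.lt_or_eq with hil | rfl
  · have hguess : (0 : ℝ) < topGuess n i := mod_cast NeZero.pos (topGuess n i)
    have hratio : G.edgeFinset.card / (topGuess n i : ℝ) ^ 2 ≤ 4 * (4 ^ i / 4 ^ l) := by
      rw [mul_div_assoc', div_le_div_iff₀ (by positivity) (by positivity)]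
      exact hc.mul_four_pow_le hil
    linarith [min_le_right (1 / 4) (G.edgeFinset.card / (topGuess n i : ℝ) ^ 2)]
  · rw [div_self (by positivity)]
    linarith [min_le_left (1 / 4) (G.edgeFinset.card / (topGuess n i : ℝ) ^ 2)]

open Classical in
lemma prob_search_inaccurate_le (hn : n ≤ 2 ^ h) (hε : 0 < ε) (hε1 : ε ≤ 1)
    (hm : 0 < G.edgeFinset.card) (hc : IsCrossing n G.edgeFinset.card l) {k : ℕ} (hi : i ≤ l)
    (hk : l < k + i) :
    (search ε h k i).prob G (inaccurate ε G.edgeFinset.card) ≤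
      13 / 300 * (4 - 4 ^ i / 4 ^ l) + 1 / 64 := by
  induction k generalizing i with
  | zero => omega
  | succ k ih =>
    have hstep := prob_orElse_orElse_le G (belowEst n ε h (2 ^ i))
      (aboveEst ε h (2 ^ i) (topGuess n i)) (search ε h k (i + 1))
      (inaccurate ε G.edgeFinset.card)
    have hbelow := prob_belowEst_some_le_of_isCrossing G (i := i) hn hε hm hc
    have habove := prob_aboveEst_some_le_of_isCrossing G hn hε hε1 hm hc hi
    have hrest := prob_nonneg G (search ε h k (i + 1)) (inaccurate ε G.edgeFinset.card)
    rw [search]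
    rcases hi.lt_or_eq with hil | rfl
    · have hrec := ih (i := i + 1) hil (by omega)
      rw [pow_succ', mul_div_assoc] at hrec
      have hreject := mul_le_of_le_one_left hrest (mul_le_one₀
        (prob_le_one G (belowEst n ε h (2 ^ i)) {none}) (prob_nonneg G _ _)
        (prob_le_one G (aboveEst ε h (2 ^ i) (topGuess n i)) {none}))
      have hpos : (0 : ℝ) < 4 ^ i / 4 ^ l := by positivity
      linarith
    · have hreject := (mul_le_of_le_one_right
        (mul_nonneg (prob_nonneg G _ _) (prob_nonneg G _ _))
        (prob_le_one G (search ε h k (i + 1)) (inaccurate ε G.edgeFinset.card))).trans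
        (prob_none_mul_prob_none_le G hn hε hε1 hc le_rfl)
      rw [div_self (by positivity)] at hbelow habove ⊢
      linarith

end Error

section Cost

open Classical in
/-- Each level past the crossing costs at most `32` times as much as the one before, but is reached
with at most a `64`-th of the probability. -/
lemma cost_search_le_of_ge (hn : n ≤ 2 ^ h) (hε : 0 < ε) (hε1 : ε ≤ 1)
    (hc : IsCrossing n G.edgeFinset.card l) (k j : ℕ) :
    (search ε h k (l + j)).cost G ≤ 34 * levelCost ε h * 2 ^ l * 32 ^ j := by
  have hA := levelCost_nonneg ε h
  induction k generalizing j with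
  | zero =>
    simp only [search, cost]
    positivity
  | succ k ih =>
    have hguess : (0 : ℝ) < topGuess n (l + j) := mod_cast NeZero.pos (topGuess n (l + j))
    have hratio : 1 + G.edgeFinset.card / (topGuess n (l + j) : ℝ) ^ 2 ≤ 17 * 16 ^ j := by
      have hle := (div_le_iff₀ (by positivity)).mpr
        (hc.le_sixteen_pow_mul (card_edgeFinset_le_sq G) j)
      rw [pow_succ (16 : ℝ)] at hle
      linarith [one_le_pow₀ (show (1 : ℝ) ≤ 16 by norm_num) (n := j)]
    have hlevel : (belowEst n ε h (2 ^ (l + j))).cost G +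
        (aboveEst ε h (2 ^ (l + j)) (topGuess n (l + j))).cost G ≤
          17 * levelCost ε h * 2 ^ l * 32 ^ j :=
      calc _ ≤ levelCost ε h * (2 ^ (l + j) : ℕ) *
            (1 + G.edgeFinset.card / (topGuess n (l + j) : ℝ) ^ 2) :=
            cost_belowEst_add_cost_aboveEst_le G hn hε hε1 (by positivity)
              (topGuess_sub_one_mul_le n _)
        _ ≤ levelCost ε h * (2 ^ (l + j) : ℕ) * (17 * 16 ^ j) := by gcongr
        _ = 17 * levelCost ε h * 2 ^ l * (2 * 16) ^ j := by
            rw [mul_pow]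
            push_cast
            ring
        _ = _ := by norm_num
    have hrest := mul_le_mul (prob_none_mul_prob_none_le G hn hε hε1 hc (l.le_add_right j))
      (ih (j + 1)) (cost_nonneg G _) (by norm_num)
    rw [search]
    refine (cost_orElse_orElse_le G _ _ _).trans ?_
    rw [← add_assoc, pow_succ (32 : ℝ)] at hrest
    linarith

open Classical in
lemma cost_search_le (hn : n ≤ 2 ^ h) (hε : 0 < ε) (hε1 : ε ≤ 1)
    (hc : IsCrossing n G.edgeFinset.card l) (k : ℕ) (hi : i ≤ l) :
    (search ε h k i).cost G ≤ levelCost ε h * (36 * 2 ^ l - 2 * 2 ^ i) := by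
  have hA := levelCost_nonneg ε h
  induction k generalizing i with
  | zero =>
    have hpow : (2 : ℝ) ^ i ≤ 2 ^ l := pow_le_pow_right₀ one_le_two hi
    have hpos : (0 : ℝ) < 2 ^ l := by positivity
    exact mul_nonneg hA (by linarith)
  | succ k ih =>
    rcases hi.lt_or_eq with hil | rfl
    · have hratio : 1 + G.edgeFinset.card / (topGuess n i : ℝ) ^ 2 ≤ 2 := by
        linarith [div_le_one_of_le₀ (hc.bounds_of_lt i hil).2.le (by positivity)]
      have hlevel : (belowEst n ε h (2 ^ i)).cost G +
          (aboveEst ε h (2 ^ i) (topGuess n i)).cost G ≤ levelCost ε h * 2 ^ i * 2 :=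
        calc _ ≤ levelCost ε h * (2 ^ i : ℕ) *
              (1 + G.edgeFinset.card / (topGuess n i : ℝ) ^ 2) :=
              cost_belowEst_add_cost_aboveEst_le G hn hε hε1 (by positivity)
                (topGuess_sub_one_mul_le n _)
          _ ≤ levelCost ε h * (2 ^ i : ℕ) * 2 := by gcongr
          _ = _ := by rw [Nat.cast_pow, Nat.cast_ofNat]
      have hreject := mul_le_of_le_one_left (cost_nonneg G (search ε h k (i + 1)))
        (mul_le_one₀ (prob_le_one G (belowEst n ε h (2 ^ i)) {none}) (prob_nonneg G _ _)
          (prob_le_one G (aboveEst ε h (2 ^ i) (topGuess n i)) {none}))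
      have hrec := ih (i := i + 1) hil
      rw [search]
      refine (cost_orElse_orElse_le G _ _ _).trans ?_
      rw [pow_succ] at hrec
      linarith
    · refine (cost_search_le_of_ge G hn hε hε1 hc (k + 1) 0).trans_eq ?_
      ring

end Cost

end QueryProg

lemma IsCrossing.two_pow_le {n : ℕ} {m : ℝ} {l : ℕ} (h : IsCrossing n m l) (hm : 1 ≤ m)
    (hmn : m ≤ n ^ 2) : (2 : ℝ) ^ l ≤ 3 * min √m √(n / √m) := by
  have hsq : ((2 : ℝ) ^ l) ^ 2 = 4 ^ l := by
    rw [pow_right_comm]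
    norm_num
  rw [mul_min_of_nonneg _ _ zero_le_three]
  refine le_min (le_of_sq_le_sq ?_ (by positivity)) (le_of_sq_le_sq ?_ (by positivity))
  · rw [hsq, mul_pow, Real.sq_sqrt (by positivity)]
    linarith [h.four_pow_le hm]
  · rw [hsq, mul_pow, Real.sq_sqrt (by positivity), mul_div_assoc', le_div_iff₀ (by positivity)]
    linarith [h.four_pow_mul_sqrt_le hmn, n.cast_nonneg (α := ℝ)]

lemma four_mul_clog_add_five_le {n : ℕ} (hn : 2 ≤ n) :
    4 * (Nat.clog 2 n : ℝ) + 5 ≤ 20 * Real.log n := by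
  have hpred : ((Nat.clog 2 n - 1 : ℕ) : ℝ) * Real.log 2 ≤ Real.log n := by
    rw [← Real.log_pow]
    exact Real.log_le_log (by positivity)
      (mod_cast (Nat.pow_pred_clog_lt_self one_lt_two hn).le)
  rw [Nat.cast_sub (Nat.clog_pos one_lt_two hn), Nat.cast_one] at hpred
  have hlog : Real.log 2 ≤ Real.log n := Real.log_le_log two_pos (mod_cast hn)
  nlinarith [Real.log_two_gt_d9]

open Classical in
lemma isIndepSet_univ_iff {n : ℕ} (G : SimpleGraph (Fin n)) :
    G.IsIndepSet (Finset.univ : Finset (Fin n)) ↔ G.edgeFinset.card = 0 := by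
  rw [← edgesWithin_eq_empty_iff, edgesWithin_univ, Finset.card_eq_zero]

open Classical in
lemma two_le_of_card_edgeFinset_pos {n : ℕ} {G : SimpleGraph (Fin n)}
    (hm : 0 < G.edgeFinset.card) : 2 ≤ n := by
  have hchoose := G.card_edgeFinset_le_card_choose_two
  rw [Fintype.card_fin] at hchoose
  exact Nat.choose_ne_zero_iff.mp (hm.trans_le hchoose).ne'

lemma compl_inaccurate (ε m : ℝ) :
    (QueryProg.inaccurate ε m)ᶜ = Set.Icc ((1 - ε) * m) ((1 + ε) * m) := by
  ext x
  rw [Set.mem_compl_iff, QueryProg.inaccurate, Set.mem_ofPred_eq, not_lt, abs_le, Set.mem_Icc]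
  constructor <;> rintro ⟨_, _⟩ <;> constructor <;> linarith

namespace QueryProg

lemma one_le_levelCost {ε : ℝ} (hε : 0 < ε) (hε1 : ε ≤ 1) (h : ℕ) : 1 ≤ levelCost ε h := by
  rw [levelCost, one_le_div (by positivity)]
  linarith [pow_le_one₀ hε.le hε1 (n := 2), h.cast_nonneg (α := ℝ)]

/-- The algorithm estimating the number of edges: output `0` if the whole vertex set is
independent, and search through all levels otherwise. -/
noncomputable def edgeEst (n : ℕ) [NeZero n] (ε : ℝ) : QueryProg n ℝ :=
  ifIndep Finset.univ (ret 0) (search ε (Nat.clog 2 n) (n + 1) 0)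

variable {n : ℕ} [NeZero n] (G : SimpleGraph (Fin n)) {ε : ℝ}

open Classical in
lemma returnsWithin_edgeEst (ε : ℝ) (hm : G.edgeFinset.card = 0) :
    ReturnsWithin G (edgeEst n ε) 0 (1 + 0) :=
  (ReturnsWithin.ret 0).ifIndep_of_isIndepSet _ ((isIndepSet_univ_iff G).mpr hm)

open Classical in
theorem two_thirds_le_prob_edgeEst (hε : 0 < ε) (hε1 : ε ≤ 1) :
    2 / 3 ≤ (edgeEst n ε).prob G
      (Set.Icc ((1 - ε) * G.edgeFinset.card) ((1 + ε) * G.edgeFinset.card)) := by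
  rcases G.edgeFinset.card.eq_zero_or_pos with hm | hm
  · rw [prob, (returnsWithin_edgeEst G ε hm).mean_eq, hm, Nat.cast_zero, mul_zero, mul_zero,
      Set.Icc_self, Set.indicator_of_mem (Set.mem_singleton 0), Pi.one_apply]
    norm_num
  · obtain ⟨l, hl, hc⟩ := exists_isCrossing (card_edgeFinset_le_sq G)
    have hbad := prob_search_inaccurate_le G (Nat.le_pow_clog one_lt_two n) hε hε1 hm hc
      (k := n + 1) l.zero_le (by omega)
    have hpos : (0 : ℝ) < 4 ^ 0 / 4 ^ l := by positivity
    rw [edgeEst, prob, mean_ifIndep, if_neg (mt (isIndepSet_univ_iff G).mp hm.ne'), ← prob,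
      ← compl_inaccurate]
    linarith [prob_add_prob_compl G (search ε (Nat.clog 2 n) (n + 1) 0)
      (inaccurate ε G.edgeFinset.card)]

open Classical in
theorem cost_edgeEst_le (hε : 0 < ε) (hε1 : ε ≤ 1) (hm : 0 < G.edgeFinset.card) :
    (edgeEst n ε).cost G ≤ 12960000000 * (Real.log n / ε ^ 2) *
      min √(G.edgeFinset.card : ℝ) √(n / √(G.edgeFinset.card : ℝ)) := by
  obtain ⟨l, -, hc⟩ := exists_isCrossing (card_edgeFinset_le_sq G)
  have hsearch := cost_search_le G (Nat.le_pow_clog one_lt_two n) hε hε1 hc (n + 1) l.zero_le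
  have hone := one_le_levelCost hε hε1 (Nat.clog 2 n)
  have hclog := four_mul_clog_add_five_le (two_le_of_card_edgeFinset_pos hm)
  have hlevel : levelCost ε (Nat.clog 2 n) ≤ 6000000 * (20 * Real.log n) / ε ^ 2 := by
    rw [levelCost]
    gcongr
  have hlevels := hc.two_pow_le (mod_cast hm) (card_edgeFinset_le_sq G)
  rw [edgeEst, cost_ifIndep, if_neg (mt (isIndepSet_univ_iff G).mp hm.ne')]
  calc _ ≤ levelCost ε (Nat.clog 2 n) * (36 * 2 ^ l) := by linarith
    _ ≤ 6000000 * (20 * Real.log n) / ε ^ 2 *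
        (36 * (3 * min √(G.edgeFinset.card : ℝ) √(n / √(G.edgeFinset.card : ℝ)))) := by gcongr
    _ = _ := by ring

end QueryProg

theorem mainTheorem1_general :
    ∃ (C : ℝ) (A : (n : ℕ) → (ε : ℝ) → GraphAlgorithm n),
      0 < C ∧
      ∀ (n : ℕ) (ε : ℝ), 1 ≤ n → 0 < ε → ε ≤ 1 →
        ∀ (G : SimpleGraph (Fin n)) (m : ℕ), m = G.edgeSet.ncard →
          (A n ε).outputProb G Set.univ = 1 ∧
          2 / 3 ≤ (A n ε).outputProb G (Set.Icc ((1 - ε) * (m : ℝ)) ((1 + ε) * (m : ℝ))) ∧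
          (1 ≤ m →
            (A n ε).expectedQueries G ≤
              ENNReal.ofReal (C * (Real.log (n : ℝ) / ε ^ 2) *
                min (Real.sqrt (m : ℝ)) (Real.sqrt ((n : ℝ) / Real.sqrt (m : ℝ))))) ∧
          (m = 0 → (A n ε).expectedQueries G ≤ 1) := by
  classical
  refine ⟨12960000000, fun n ε => if hn : n = 0 then (QueryProg.ret 0).toAlgorithm else
    haveI := NeZero.mk hn; (QueryProg.edgeEst n ε).toAlgorithm, by norm_num, ?_⟩
  rintro n ε hn hε hε1 G m rfl
  have : NeZero n := .of_pos hn
  rw [← SimpleGraph.coe_edgeFinset, Set.ncard_coe_finset]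
  simp only [dif_neg (NeZero.ne n)]
  refine ⟨QueryProg.outputProb_univ G _, ?_, fun hm => ?_, fun hm => ?_⟩
  · refine le_trans ?_ ((ENNReal.ofReal_le_ofReal
      (QueryProg.two_thirds_le_prob_edgeEst G hε hε1)).trans
      (QueryProg.ofReal_prob_le_outputProb G _ _))
    rw [ENNReal.ofReal_div_of_pos three_pos, ENNReal.ofReal_ofNat, ENNReal.ofReal_ofNat]
  · exact (QueryProg.expectedQueries_toAlgorithm_le G _).trans
      (ENNReal.ofReal_le_ofReal (QueryProg.cost_edgeEst_le G hε hε1 hm))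
  · refine (QueryProg.expectedQueries_toAlgorithm_le G _).trans (ENNReal.ofReal_le_one.mpr ?_)
    exact (QueryProg.returnsWithin_edgeEst G ε hm).cost_le.trans_eq (add_zero 1)

theorem mainTheorem1 :
    ∃ (C : ℝ) (A : (n : ℕ) → (ε : ℝ) → GraphAlgorithm n),
      0 < C ∧
      ∀ (n : ℕ) (ε : ℝ), 1 ≤ n → 0 < ε → ε ≤ 1 →
        ∀ (G : SimpleGraph (Fin n)) (m : ℕ), m = G.edgeSet.ncard →
          -- the algorithm halts almost surely
          (A n ε).outputProb G Set.univ = 1 ∧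
          -- the output is a `(1 ± ε)`-approximation of `m` with probability at least `2/3`
          2 / 3 ≤ (A n ε).outputProb G (Set.Icc ((1 - ε) * (m : ℝ)) ((1 + ε) * (m : ℝ))) ∧
          -- the expected number of queries
          (1 ≤ m →
            (A n ε).expectedQueries G ≤
              ENNReal.ofReal (C * (Real.log (n : ℝ) / ε ^ (5 / 2 : ℝ)) *
                min (Real.sqrt (m : ℝ)) (Real.sqrt ((n : ℝ) / Real.sqrt (m : ℝ))))) ∧
          (m = 0 → (A n ε).expectedQueries G ≤ 1) := by
  obtain ⟨C, A, hC, hA⟩ := mainTheorem1_general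
  refine ⟨C, A, hC, fun n ε hn hε hε1 G m hm => ?_⟩
  obtain ⟨hhalt, hprob, hcost, hcost0⟩ := hA n ε hn hε hε1 G m hm
  refine ⟨hhalt, hprob, fun hm1 => (hcost hm1).trans (ENNReal.ofReal_le_ofReal ?_), hcost0⟩
  have hpow : ε ^ (5 / 2 : ℝ) ≤ ε ^ 2 := by
    rw [← Real.rpow_natCast]
    exact Real.rpow_le_rpow_of_exponent_ge hε hε1 (by norm_num)
  gcongr
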